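/- A Motzkin path of width $n$ is a sequence of $n$ moves $U$ (up-right), $H$ (horizontal-right), $D$ (down-right) in the lattice that starts at $(0,0)$, never goes below the axis $y=0$ and ends on it; its area is the area between the path and the axis. The height of a move is the maximum height of the path during that move. The weight $\omega(mz)$ of a path $mz$ is the product over its moves of $h$ for every $U$ or $D$ of height $h$ and of $2h+1$ for every $H$ of height $h$. Let $f_h$ be the number of $H$ moves of height $h$, and let $p_h$ be the number of $U$ moves of height $h$ (equivalently, of $D$ moves of height $h$). For $n,d,h,p\ge 0$ let $D(n,d,h,p)$ be the sum of $\omega(mz)$ over all Motzkin paths $mz$ of width $n$, area $d$ and topmost level $h$ with $p_h=p$ and $f_h=0$. Here "topmost level $h$" means that the path has height $h$, or that it has height $h-1$ (so that level $h$ is empty and $p=0$). Put $$D(n,d,h):=D(n,d,h+1,0),\qquad D(n,d):=\sum_{h=0}^{n}D(n,d,h).$$ Then $D(n,d)$ is the number of permutations $\pi$ of $\{1,\dots,n\}$ with $\sum_{i=1}^n|i-\pi(i)|=2d$. For the parameters with $n\le N$, all non-zero values $D(n,d,h,p)$ have $d\le N^2$, $h\le N+1$ and $p\le N$, which leaves $\mathcal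 O(N^5)$ parameter values as $N$ ranges over the positive integers. There is a single program for a random access machine (registers and indirectly addressed arrays of natural numbers; unit cost for each assignment, addition, truncated subtraction, multiplication, array access and zero test) that, on input $N$, computes the values $D(n,d,h,p)$, $D(n,d,h)$ and $D(n,d)$ for all these parameters (for $D(n,d,h)$, all $h\le N$) and stores them in three arrays in row-major order. For $N\ge1$ it does so in $\mathcal O(N^7)$ total time. -/

import Mathlib

namespace DisplacementTable

/-! ### Permutations and total displacement -/

/-- The total displacement `∑ i, |i - π i|` of a permutation of `n` elements. -/
def displacement {n : ℕ} (π : Equiv.Perm (Fin n)) : ℤ :=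
  ∑ i : Fin n, |(i.val : ℤ) - ((π i).val : ℤ)|

/-- The number of permutations of `n` elements with total displacement `2 d`. -/
def displacementNumber (n d : ℕ) : ℕ :=
  (Finset.univ.filter fun π : Equiv.Perm (Fin n) => displacement π = 2 * (d : ℤ)).card

/-! ### Motzkin paths -/

/-- A move of a lattice path: up-right, horizontal-right or down-right. -/
inductive Move where
  | up
  | flat
  | down
  deriving DecidableEq

instance : Fintype Move where
  elems := {.up, .flat, .down}
  complete := by intro x; cases x <;> simp

/-- The change of the `y`-coordinate under a move. -/
def Move.step : Move → ℤ
  | .up => 1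
  | .flat => 0
  | .down => -1

/-- The height (`y`-coordinate) of the path after its first `i` moves, starting at `(0, 0)`. -/
def heightAt {n : ℕ} (mz : Fin n → Move) (i : ℕ) : ℤ :=
  ∑ j : Fin n, if j.val < i then (mz j).step else 0

/-- The Motzkin paths of width `n`: the sequences of `n` moves which never go below the axis and
end on the axis. -/
def motzkinPaths (n : ℕ) : Finset (Fin n → Move) :=
  Finset.univ.filter fun mz : Fin n → Move =>
    (∀ i : Fin (n + 1), 0 ≤ heightAt mz i.val) ∧ heightAt mz n = 0

/-- Twice the area between the axis and the path: over move `j` the region is a trapezoid of width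
one whose parallel sides are the heights before and after the move. -/
def twiceArea {n : ℕ} (mz : Fin n → Move) : ℤ :=
  ∑ j : Fin n, (heightAt mz j.val + heightAt mz (j.val + 1))

/-- The maximum height of the path during move `j`. -/
def moveHeight {n : ℕ} (mz : Fin n → Move) (j : Fin n) : ℕ :=
  (max (heightAt mz j.val) (heightAt mz (j.val + 1))).toNat

/-- The maximum height of the path. -/
def pathHeight {n : ℕ} (mz : Fin n → Move) : ℕ :=
  (Finset.range (n + 1)).sup fun i => (heightAt mz i).toNat

/-- The number of flats of height `h`. -/
def flatCount {n : ℕ} (mz : Fin n → Move) (h : ℕ) : ℕ :=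
  (Finset.univ.filter fun j : Fin n => mz j = Move.flat ∧ moveHeight mz j = h).card

/-- The number of peaks of height `h` among the building blocks of the path. Such a block is split
into one up move and one down move of height `h`, so this is the number of up moves of height `h`
(in a Motzkin path there are equally many down moves of height `h`). -/
def peakCount {n : ℕ} (mz : Fin n → Move) (h : ℕ) : ℕ :=
  (Finset.univ.filter fun j : Fin n => mz j = Move.up ∧ moveHeight mz j = h).card

/-- The weight of a path: a factor `h` for each up or down move of height `h`, and a factor
`2 h + 1` for each flat of height `h`. -/
def weight {n : ℕ} (mz : Fin n → Move) : ℕ :=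
  ∏ j : Fin n, if mz j = Move.flat then 2 * moveHeight mz j + 1 else moveHeight mz j

/-! ### The table and its marginals -/

/-- `D(n, d, h, p)`: the total weight of the Motzkin paths of width `n` and area `d` with exactly
`p` peaks and no flats at height `h`, whose topmost level is `h`. Level `h` may be empty (`p = 0`),
on top of a path of height `h - 1`; if `0 < p`, the condition says that the path has height `h`. -/
def weightTable (n d h p : ℕ) : ℕ :=
  ∑ mz ∈ (motzkinPaths n).filter fun mz =>
    twiceArea mz = 2 * (d : ℤ) ∧ (pathHeight mz = h ∨ pathHeight mz + 1 = h) ∧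
      peakCount mz h = p ∧ flatCount mz h = 0, weight mz

/-- The marginal `D(n, d, h) = D(n, d, h + 1, 0)`. -/
def heightMarginal (n d h : ℕ) : ℕ := weightTable n d (h + 1) 0

/-- The marginal `D(n, d) = ∑_{h = 0}^{n} D(n, d, h)`. -/
def totalMarginal (n d : ℕ) : ℕ := ∑ h ∈ Finset.range (n + 1), heightMarginal n d h

/-- The parameter values `(n, d, h, p)` with `n ≤ N`, `d ≤ N²`, `h ≤ N + 1`, `p ≤ N`. -/
def parameters (N : ℕ) : Finset (ℕ × ℕ × ℕ × ℕ) :=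
  Finset.range (N + 1) ×ˢ Finset.range (N ^ 2 + 1) ×ˢ Finset.range (N + 2) ×ˢ Finset.range (N + 1)

/-! ### Unit-cost random access machine -/

/-- The memory: scalar registers and arrays, holding natural numbers. A program mentions only
finitely many registers and arrays, all by fixed names; arrays are addressed indirectly. -/
structure Memory where
  /-- contents of the registers -/
  reg : ℕ → ℕ
  /-- contents of the arrays -/
  arr : ℕ → ℕ → ℕ

/-- The elementary instructions. -/
inductive Instr where
  /-- `x := c` -/
  | const (x c : ℕ)
  /-- `x := y` -/
  | copy (x y : ℕ)
  /-- `x := y + z` -/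
  | add (x y z : ℕ)
  /-- `x := max (y - z) 0` -/
  | sub (x y z : ℕ)
  /-- `x := y * z` -/
  | mul (x y z : ℕ)
  /-- `x := a[y]` -/
  | load (x a y : ℕ)
  /-- `a[x] := y` -/
  | store (a x y : ℕ)

/-- Write the value `v` into register `x`. -/
def Memory.setReg (m : Memory) (x v : ℕ) : Memory :=
  { m with reg := Function.update m.reg x v }

/-- Write the value `v` into cell `i` of array `a`. -/
def Memory.setArr (m : Memory) (a i v : ℕ) : Memory :=
  { m with arr := Function.update m.arr a (Function.update (m.arr a) i v) }

/-- The effect of an elementary instruction. -/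
def Instr.apply : Instr → Memory → Memory
  | .const x c, m => m.setReg x c
  | .copy x y, m => m.setReg x (m.reg y)
  | .add x y z, m => m.setReg x (m.reg y + m.reg z)
  | .sub x y z, m => m.setReg x (m.reg y - m.reg z)
  | .mul x y z, m => m.setReg x (m.reg y * m.reg z)
  | .load x a y, m => m.setReg x (m.arr a (m.reg y))
  | .store a x y, m => m.setArr a (m.reg x) (m.reg y)

/-- Programs. -/
inductive Program where
  /-- do nothing -/
  | skip
  /-- an elementary instruction -/
  | instr (i : Instr)
  /-- first `P`, then `Q` -/
  | seq (P Q : Program)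
  /-- if register `x` is nonzero then `P` else `Q` -/
  | branch (x : ℕ) (P Q : Program)
  /-- while register `x` is nonzero do `P` -/
  | loop (x : ℕ) (P : Program)

/-- `Runs P m t m'`: the program `P`, started with memory `m`, halts after `t` steps with memory
`m'`. Each elementary instruction and each test of a register for zero is one step. -/
inductive Runs : Program → Memory → ℕ → Memory → Prop where
  | skip (m : Memory) : Runs .skip m 1 m
  | instr (i : Instr) (m : Memory) : Runs (.instr i) m 1 (i.apply m)
  | seq {P Q : Program} {m₁ m₂ m₃ : Memory} {s t : ℕ} (hP : Runs P m₁ s m₂)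
      (hQ : Runs Q m₂ t m₃) : Runs (.seq P Q) m₁ (s + t) m₃
  | branch_true {x : ℕ} {P Q : Program} {m m' : Memory} {t : ℕ} (hx : m.reg x ≠ 0)
      (hP : Runs P m t m') : Runs (.branch x P Q) m (t + 1) m'
  | branch_false {x : ℕ} {P Q : Program} {m m' : Memory} {t : ℕ} (hx : m.reg x = 0)
      (hQ : Runs Q m t m') : Runs (.branch x P Q) m (t + 1) m'
  | loop_true {x : ℕ} {P : Program} {m₁ m₂ m₃ : Memory} {s t : ℕ} (hx : m₁.reg x ≠ 0)
      (hP : Runs P m₁ s m₂) (hL : Runs (.loop x P) m₂ t m₃) :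
      Runs (.loop x P) m₁ (s + t + 1) m₃
  | loop_false {x : ℕ} {P : Program} {m : Memory} (hx : m.reg x = 0) :
      Runs (.loop x P) m 1 m

/-- The initial memory: the input `N` in register `0`, and zeros everywhere else. -/
def inputMemory (N : ℕ) : Memory where
  reg := Function.update (fun _ => 0) 0 N
  arr := fun _ _ => 0

/-- The memory holds all values of the table for the bound `N` in array `0`, those of the marginal
`D(n, d, h)` in array `1` and those of the marginal `D(n, d)` in array `2`, where
`0 ≤ n ≤ N`, `0 ≤ d ≤ N²`, `0 ≤ h ≤ N + 1` (in array `1`, `0 ≤ h ≤ N`) and `0 ≤ p ≤ N`, each array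
in row-major order. -/
def HoldsTables (N : ℕ) (m : Memory) : Prop :=
  (∀ n ≤ N, ∀ d ≤ N ^ 2, ∀ h ≤ N + 1, ∀ p ≤ N,
    m.arr 0 (((n * (N ^ 2 + 1) + d) * (N + 2) + h) * (N + 1) + p) = weightTable n d h p) ∧
  (∀ n ≤ N, ∀ d ≤ N ^ 2, ∀ h ≤ N,
    m.arr 1 ((n * (N ^ 2 + 1) + d) * (N + 1) + h) = heightMarginal n d h) ∧
  (∀ n ≤ N, ∀ d ≤ N ^ 2,
    m.arr 2 (n * (N ^ 2 + 1) + d) = totalMarginal n d)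

end DisplacementTable

/-! The weight of a path is a product of factors that depend only on the kind and the height of each
move. Splitting off the last move therefore gives a three-term recursion in the final height,
`transfer`, valid for arbitrary factors in a commutative semiring (`sum_pathsTo`). A Motzkin path
starts and ends at height 0, so its area is the sum of the heights after its moves, and a power of a
marker in each factor records it.

For the permutations, let an arrow j ↦ l be either unmarked, with weight X^|j-l|, or marked, with
weight X^(j+l+2) Y. A new leftmost point is either fixed or inserted into an old arrow, and shifting
the old points replaces Y by X^2 Y. Hence the generating polynomials satisfy A_{n+1}(Y) = ((1+Y) A_n
+ (1+Y)^2 A_n')(X^2 Y) (`arrowPoly_succ`). The coefficient of Y^k obeys the transfer recursion for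
paths to height k (`coeff_arrowPoly`). At k = 0 no arrow is marked and the displacement polynomial
remains.

For the computation, the factors `levelWeight h` forbid moves above level h and flats at level h,
and mark the up moves at level h. The coefficients `prefixWeight h n a y p` fill a box of O(N^6)
cells, and each follows from at most four cells with smaller n by a fixed expression
(`prefixWeight_succ`). A table value is one such coefficient, or a difference of two when p = 0 and
h ≥ 2 (`weightTable_eq`). The marginals need only lookups and running sums.

The machine enters through a small compiler with step counts and one general fact, `fill_triple`: an
expression that finds each cell from cells of smaller row-major index fills the array. The cost is
O(N^6), within the claimed O(N^7). -/

namespace DisplacementTable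

/-! ### Structured programs with expressions and counting loops -/

/-- Arithmetic expressions over variables and array cells. -/
inductive Expr where
  | const (c : ℕ)
  | var (x : ℕ)
  | add (e f : Expr)
  | sub (e f : Expr)
  | mul (e f : Expr)
  | load (a : ℕ) (e : Expr)

namespace Expr

instance : Add Expr := ⟨add⟩
instance : Sub Expr := ⟨sub⟩
instance : Mul Expr := ⟨mul⟩

/-- The value of an expression. -/
def eval (m : Memory) : Expr → ℕ
  | const c => c
  | var x => m.reg x
  | add e f => e.eval m + f.eval m
  | sub e f => e.eval m - f.eval m
  | mul e f => e.eval m * f.eval m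
  | load a e => m.arr a (e.eval m)

@[simp] theorem eval_const (m : Memory) (c : ℕ) : (const c).eval m = c := rfl
@[simp] theorem eval_var (m : Memory) (x : ℕ) : (var x).eval m = m.reg x := rfl
@[simp] theorem eval_add (m : Memory) (e f : Expr) : (e + f).eval m = e.eval m + f.eval m := rfl
@[simp] theorem eval_sub (m : Memory) (e f : Expr) : (e - f).eval m = e.eval m - f.eval m := rfl
@[simp] theorem eval_mul (m : Memory) (e f : Expr) : (e * f).eval m = e.eval m * f.eval m := rfl
@[simp] theorem eval_load (m : Memory) (a : ℕ) (e : Expr) :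
    (load a e).eval m = m.arr a (e.eval m) := rfl

/-- The number of steps to evaluate an expression. -/
def cost : Expr → ℕ
  | const _ => 1
  | var _ => 1
  | add e f => e.cost + (f.cost + 1)
  | sub e f => e.cost + (f.cost + 1)
  | mul e f => e.cost + (f.cost + 1)
  | load _ e => e.cost + 1

/-- A program which evaluates an expression into the temporary register `2 * d + 1`, using no
temporary registers below that one. The variable `x` lives in register `2 * x`. -/
def compile : Expr → ℕ → Program
  | const c, d => .instr (.const (2 * d + 1) c)
  | var x, d => .instr (.copy (2 * d + 1) (2 * x))
  | add e f, d => .seq (e.compile d) (.seq (f.compile (d + 1))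
      (.instr (.add (2 * d + 1) (2 * d + 1) (2 * (d + 1) + 1))))
  | sub e f, d => .seq (e.compile d) (.seq (f.compile (d + 1))
      (.instr (.sub (2 * d + 1) (2 * d + 1) (2 * (d + 1) + 1))))
  | mul e f, d => .seq (e.compile d) (.seq (f.compile (d + 1))
      (.instr (.mul (2 * d + 1) (2 * d + 1) (2 * (d + 1) + 1))))
  | load a e, d => .seq (e.compile d) (.instr (.load (2 * d + 1) a (2 * d + 1)))

end Expr

/-- The machine memory `m` holds the variables of `σ` in the even registers, and its arrays. -/
def Represents (m σ : Memory) : Prop :=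
  (∀ x, m.reg (2 * x) = σ.reg x) ∧ m.arr = σ.arr

/-- The temporary registers with number below `d` agree. -/
def SameTemps (d : ℕ) (m m' : Memory) : Prop :=
  ∀ r < d, m'.reg (2 * r + 1) = m.reg (2 * r + 1)

theorem SameTemps.refl (d : ℕ) (m : Memory) : SameTemps d m m := fun _ _ => rfl

theorem SameTemps.trans {d e : ℕ} {m₁ m₂ m₃ : Memory} (h : SameTemps d m₁ m₂)
    (h' : SameTemps e m₂ m₃) (hde : d ≤ e) : SameTemps d m₁ m₃ :=
  fun r hr => (h' r (by omega)).trans (h r hr)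

theorem SameTemps.setReg {d r : ℕ} {m m' : Memory} (h : SameTemps d m m') (hr : d ≤ r) (v : ℕ) :
    SameTemps d m (m'.setReg (2 * r + 1) v) := fun s hs => by
  rw [← h s hs]
  exact Function.update_of_ne (by omega) _ _

theorem SameTemps.setVar {d : ℕ} {m m' : Memory} (h : SameTemps d m m') (x v : ℕ) :
    SameTemps d m (m'.setReg (2 * x) v) := fun s hs => by
  rw [← h s hs]
  exact Function.update_of_ne (by omega) _ _

theorem Represents.setTemp {m σ : Memory} (h : Represents m σ) (r v : ℕ) :
    Represents (m.setReg (2 * r + 1) v) σ :=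
  ⟨fun x => by rw [← h.1 x]; exact Function.update_of_ne (by omega) _ _, h.2⟩

theorem Represents.setVar {m σ : Memory} (h : Represents m σ) (x v : ℕ) :
    Represents (m.setReg (2 * x) v) (σ.setReg x v) :=
  ⟨fun y => by
    by_cases hy : y = x
    · subst hy; simp [Memory.setReg]
    · have := h.1 y
      simpa [Memory.setReg, Function.update_of_ne, hy] using this, h.2⟩

theorem Represents.setArr {m σ : Memory} (h : Represents m σ) (a i v : ℕ) :
    Represents (m.setArr a i v) (σ.setArr a i v) :=
  ⟨h.1, by simp only [Memory.setArr, h.2]⟩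

@[simp] theorem reg_setReg_self (m : Memory) (x v : ℕ) : (m.setReg x v).reg x = v := by
  simp [Memory.setReg]

theorem reg_setReg_of_ne (m : Memory) {x y : ℕ} (v : ℕ) (h : y ≠ x) :
    (m.setReg x v).reg y = m.reg y := Function.update_of_ne h _ _

@[simp] theorem arr_setReg (m : Memory) (x v : ℕ) : (m.setReg x v).arr = m.arr := rfl

@[simp] theorem reg_setArr (m : Memory) (a i v : ℕ) : (m.setArr a i v).reg = m.reg := rfl

/-- Variables sit in even registers and temporaries in odd ones, so evaluation never disturbs a
variable. A second operand uses only temporaries from `d + 1` on, so the first operand survives in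
temporary `d`. -/
theorem Expr.runs_compile (e : Expr) : ∀ (d : ℕ) {m σ : Memory}, Represents m σ →
    ∃ m', Runs (e.compile d) m e.cost m' ∧ Represents m' σ ∧ m'.reg (2 * d + 1) = e.eval σ ∧
      SameTemps d m m' := by
  have binary (e f : Expr) (op : ℕ → ℕ → ℕ → Instr) (o : ℕ → ℕ → ℕ)
      (hop : ∀ x y z m, (op x y z).apply m = m.setReg x (o (m.reg y) (m.reg z)))
      (he : ∀ (d : ℕ) {m σ : Memory}, Represents m σ →
        ∃ m', Runs (e.compile d) m e.cost m' ∧ Represents m' σ ∧ m'.reg (2 * d + 1) = e.eval σ ∧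
          SameTemps d m m')
      (hf : ∀ (d : ℕ) {m σ : Memory}, Represents m σ →
        ∃ m', Runs (f.compile d) m f.cost m' ∧ Represents m' σ ∧ m'.reg (2 * d + 1) = f.eval σ ∧
          SameTemps d m m') (d : ℕ) {m σ : Memory} (h : Represents m σ) :
      ∃ m', Runs (.seq (e.compile d) (.seq (f.compile (d + 1))
          (.instr (op (2 * d + 1) (2 * d + 1) (2 * (d + 1) + 1))))) m
          (e.cost + (f.cost + 1)) m' ∧ Represents m' σ ∧
        m'.reg (2 * d + 1) = o (e.eval σ) (f.eval σ) ∧ SameTemps d m m' := by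
    obtain ⟨m₁, r₁, h₁, v₁, s₁⟩ := he d h
    obtain ⟨m₂, r₂, h₂, v₂, s₂⟩ := hf (d + 1) h₁
    refine ⟨_, .seq r₁ (.seq r₂ (.instr _ _)), ?_, ?_, ?_⟩
    · rw [hop]; exact h₂.setTemp _ _
    · rw [hop, reg_setReg_self, v₂, s₂ d (by omega), v₁]
    · rw [hop]; exact (s₁.trans s₂ (by omega)).setReg le_rfl _
  induction e with
  | const c =>
    intro d m σ h
    exact ⟨_, .instr _ _, h.setTemp _ _, reg_setReg_self _ _ _, (SameTemps.refl d m).setReg le_rfl _⟩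
  | var x =>
    intro d m σ h
    exact ⟨_, .instr _ _, h.setTemp _ _, (reg_setReg_self _ _ _).trans (h.1 x),
      (SameTemps.refl d m).setReg le_rfl _⟩
  | add e f he hf => exact binary e f .add (· + ·) (fun _ _ _ _ => rfl) he hf
  | sub e f he hf => exact binary e f .sub (· - ·) (fun _ _ _ _ => rfl) he hf
  | mul e f he hf => exact binary e f .mul (· * ·) (fun _ _ _ _ => rfl) he hf
  | load a e he =>
    intro d m σ h
    obtain ⟨m₁, r₁, h₁, v₁, s₁⟩ := he d h
    refine ⟨_, .seq r₁ (.instr _ _), h₁.setTemp _ _, ?_, s₁.setReg le_rfl _⟩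
    exact (reg_setReg_self _ _ _).trans (by rw [v₁, h₁.2]; rfl)

/-- A statement: a program which may use the temporary registers from a given number on. -/
abbrev Stmt := ℕ → Program

/-- Started in a state with `pre`, the statement `s` halts after at most `c` steps in a state with
`post`. -/
def Triple (pre : Memory → Prop) (s : Stmt) (c : ℕ) (post : Memory → Prop) : Prop :=
  ∀ (d : ℕ) (m σ : Memory), Represents m σ → pre σ →
    ∃ t ≤ c, ∃ m' σ', Runs (s d) m t m' ∧ Represents m' σ' ∧ post σ' ∧ SameTemps d m m'

/-- First `s`, then `s'`. -/
def Stmt.seq (s s' : Stmt) : Stmt := fun d => .seq (s d) (s' d)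

/-! ### Rules for timed Hoare triples -/

theorem Triple.seq {P Q R : Memory → Prop} {s s' : Stmt} {c c' : ℕ} (h : Triple P s c Q)
    (h' : Triple Q s' c' R) : Triple P (s.seq s') (c + c') R := by
  intro d m σ hm hP
  obtain ⟨t, ht, m₁, σ₁, r₁, h₁, q₁, s₁⟩ := h d m σ hm hP
  obtain ⟨t', ht', m₂, σ₂, r₂, h₂, q₂, s₂⟩ := h' d m₁ σ₁ h₁ q₁
  exact ⟨t + t', by omega, m₂, σ₂, .seq r₁ r₂, h₂, q₂, s₁.trans s₂ le_rfl⟩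

theorem Triple.mono {P P' Q Q' : Memory → Prop} {s : Stmt} {c c' : ℕ} (h : Triple P s c Q)
    (hP : ∀ σ, P' σ → P σ) (hc : c ≤ c') (hQ : ∀ σ, Q σ → Q' σ) : Triple P' s c' Q' := by
  intro d m σ hm hp
  obtain ⟨t, ht, m₁, σ₁, r₁, h₁, q₁, s₁⟩ := h d m σ hm (hP σ hp)
  exact ⟨t, ht.trans hc, m₁, σ₁, r₁, h₁, hQ _ q₁, s₁⟩

/-- `a[e] := f` -/
def Stmt.store (a : ℕ) (e f : Expr) : Stmt := fun d =>
  .seq (e.compile d) (.seq (f.compile (d + 1)) (.instr (.store a (2 * d + 1) (2 * (d + 1) + 1))))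

theorem Triple.store {P Q : Memory → Prop} {a : ℕ} {e f : Expr}
    (h : ∀ σ, P σ → Q (σ.setArr a (e.eval σ) (f.eval σ))) :
    Triple P (Stmt.store a e f) (e.cost + (f.cost + 1)) Q := by
  intro d m σ hm hP
  obtain ⟨m₁, r₁, h₁, v₁, s₁⟩ := e.runs_compile d hm
  obtain ⟨m₂, r₂, h₂, v₂, s₂⟩ := f.runs_compile (d + 1) h₁
  refine ⟨_, le_rfl, _, σ.setArr a (e.eval σ) (f.eval σ), .seq r₁ (.seq r₂ (.instr _ _)), ?_,
    h σ hP, s₁.trans s₂ (by omega)⟩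
  have h3 := h₂.setArr a (e.eval σ) (f.eval σ)
  rw [← v₂, ← v₁, ← s₂ d (by omega)] at h3
  rw [← v₂, ← v₁, ← s₂ d (by omega)]
  exact h3

/-- `for x in 0, …, b - 1 do s` -/
def Stmt.for (x : ℕ) (b : Expr) (s : Stmt) : Stmt := fun d =>
  .seq (b.compile d) (.seq (.instr (.const (2 * (d + 1) + 1) 0)) (.loop (2 * d + 1)
    (.seq (.instr (.copy (2 * x) (2 * (d + 1) + 1))) (.seq (s (d + 2))
      (.seq (.instr (.const (2 * (d + 2) + 1) 1))
        (.seq (.instr (.add (2 * (d + 1) + 1) (2 * (d + 1) + 1) (2 * (d + 2) + 1)))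
          (.instr (.sub (2 * d + 1) (2 * d + 1) (2 * (d + 2) + 1)))))))))

/-- Temporary `d` counts the remaining rounds and `d + 1` the completed ones. The body owns only
temporaries from `d + 2` on, and the loop variable is a mere copy of the counter, so the body cannot
affect the number of rounds. A round costs the body, four instructions and a test; the final `2`
pays for clearing the counter and for the last test. -/
theorem Triple.for {x B c : ℕ} {b : Expr} {s : Stmt} {I : ℕ → Memory → Prop}
    (hb : ∀ σ, I 0 σ → b.eval σ = B)
    (hs : ∀ i < B, Triple (fun σ => ∃ τ, I i τ ∧ σ = τ.setReg x i) s c (I (i + 1))) :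
    Triple (I 0) (Stmt.for x b s) (b.cost + B * (c + 5) + 2) (I B) := by
  intro d m σ hm hI
  obtain ⟨m₁, r₁, h₁, v₁, s₁⟩ := b.runs_compile d hm
  rw [hb σ hI] at v₁
  have main : ∀ r i (m σ : Memory), i + r = B → Represents m σ → I i σ → m.reg (2 * d + 1) = r →
      m.reg (2 * (d + 1) + 1) = i → ∃ t ≤ r * (c + 5) + 1, ∃ m' σ', Runs (.loop (2 * d + 1)
    (.seq (.instr (.copy (2 * x) (2 * (d + 1) + 1))) (.seq (s (d + 2))
      (.seq (.instr (.const (2 * (d + 2) + 1) 1))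
        (.seq (.instr (.add (2 * (d + 1) + 1) (2 * (d + 1) + 1) (2 * (d + 2) + 1)))
          (.instr (.sub (2 * d + 1) (2 * d + 1) (2 * (d + 2) + 1)))))))) m t m' ∧
        Represents m' σ' ∧ I B σ' ∧ SameTemps d m m' := by
    intro r
    induction r with
    | zero =>
      intro i m σ hi hm hI hr _
      obtain rfl : i = B := by omega
      exact ⟨1, by omega, m, σ, .loop_false hr, hm, hI, .refl d m⟩
    | succ r ih =>
      intro i m σ hi hm hI hr hi'
      obtain ⟨t, ht, m₂, σ₂, r₂, h₂, I₂, s₂⟩ := hs i (by omega) (d + 2) _ _ (hm.setVar x i)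
        ⟨σ, hI, rfl⟩
      have e0 := s₂ d (by omega)
      have e1 := s₂ (d + 1) (by omega)
      rw [reg_setReg_of_ne _ _ (by omega)] at e0 e1
      obtain ⟨t', ht', m₃, σ₃, r₃, h₃, I₃, s₃⟩ := ih (i + 1)
        (((m₂.setReg (2 * (d + 2) + 1) 1).setReg (2 * (d + 1) + 1) (i + 1)).setReg (2 * d + 1) r) σ₂
        (by omega) (((h₂.setTemp _ _).setTemp _ _).setTemp _ _) I₂ (reg_setReg_self _ _ _)
        ((reg_setReg_of_ne _ _ (by omega)).trans (reg_setReg_self _ _ _))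
      have ra : Runs (s (d + 2)) ((Instr.copy (2 * x) (2 * (d + 1) + 1)).apply m) t m₂ := by
        simpa [Instr.apply, hi'] using r₂
      have rb : (Instr.sub (2 * d + 1) (2 * d + 1) (2 * (d + 2) + 1)).apply
          ((Instr.add (2 * (d + 1) + 1) (2 * (d + 1) + 1) (2 * (d + 2) + 1)).apply
            ((Instr.const (2 * (d + 2) + 1) 1).apply m₂)) =
          ((m₂.setReg (2 * (d + 2) + 1) 1).setReg (2 * (d + 1) + 1) (i + 1)).setReg
            (2 * d + 1) r := by
        simp only [Instr.apply]
        rw [reg_setReg_self, reg_setReg_of_ne _ _ (by omega), e1, hi',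
          reg_setReg_of_ne _ _ (by omega), reg_setReg_of_ne _ _ (by omega), e0, hr,
          reg_setReg_of_ne _ _ (by omega), reg_setReg_self]
        rfl
      rw [← rb] at r₃
      refine ⟨_, ?_, m₃, σ₃, .loop_true (by omega) (.seq (.instr _ _) (.seq ra
        (.seq (.instr _ _) (.seq (.instr _ _) (.instr _ _))))) r₃, h₃, I₃, ?_⟩
      · linarith
      · have hA := ((((SameTemps.refl d m).setVar x i).trans s₂ (by omega)).setReg
          (r := d + 2) (by omega) 1)
        have hB := (hA.setReg (r := d + 1) (by omega) (i + 1)).setReg (r := d) (by omega) r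
        exact hB.trans s₃ le_rfl
  obtain ⟨t, ht, m₂, σ₂, r₂, h₂, I₂, s₂⟩ := main B 0 (m₁.setReg (2 * (d + 1) + 1) 0) σ (by omega)
    (h₁.setTemp _ _) hI ((reg_setReg_of_ne _ _ (by omega)).trans v₁) (reg_setReg_self _ _ _)
  exact ⟨_, by linarith, m₂, σ₂, .seq r₁ (.seq (.instr _ _) r₂), h₂, I₂,
    (s₁.setReg (by omega) 0).trans s₂ le_rfl⟩

end DisplacementTable

namespace DisplacementTable

/-! ### Transfer recursion for weighted path prefixes -/

section Paths

variable {n : ℕ}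

theorem heightAt_snoc (mz : Fin n → Move) (x : Move) (i : ℕ) :
    heightAt (Fin.snoc mz x : Fin (n + 1) → Move) i =
      heightAt mz i + if n < i then x.step else 0 := by
  simp [heightAt, Fin.sum_univ_castSucc]

theorem heightAt_zero (mz : Fin n → Move) : heightAt mz 0 = 0 := by simp [heightAt]

theorem heightAt_succ (mz : Fin n → Move) (j : Fin n) :
    heightAt mz (j + 1) = heightAt mz j + (mz j).step := by
  have h : ∀ k : Fin n, (if k.val < j.val + 1 then (mz k).step else 0) =
      (if k.val < j.val then (mz k).step else 0) + if k = j then (mz k).step else 0 := by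
    intro k
    rcases lt_trichotomy k.val j.val with hk | hk | hk
    · simp [hk, Nat.lt_succ_of_lt hk, Fin.ne_of_lt hk]
    · simp [Fin.ext hk]
    · have : ¬ k.val < j.val + 1 := by omega
      simp [this, hk.not_gt, (Fin.ne_of_lt hk).symm]
  simp only [heightAt, h, Finset.sum_add_distrib, Finset.sum_ite_eq', Finset.mem_univ, if_true]

theorem step_le_one (x : Move) : x.step ≤ 1 := by cases x <;> simp [Move.step]

theorem heightAt_le (mz : Fin n → Move) (i : ℕ) (hi : i ≤ n) : heightAt mz i ≤ i := by
  induction i with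
  | zero => simp [heightAt_zero]
  | succ i ih =>
    have h1 := heightAt_succ mz ⟨i, hi⟩
    have h2 := ih (by omega)
    have h3 := step_le_one (mz ⟨i, hi⟩)
    simp only at h1
    push_cast
    omega

/-- The sequences of `n` moves which never go below the axis and end at height `y`. -/
def pathsTo (n y : ℕ) : Finset (Fin n → Move) :=
  Finset.univ.filter fun mz : Fin n → Move =>
    (∀ i : Fin (n + 1), 0 ≤ heightAt mz i.val) ∧ heightAt mz n = y

theorem motzkinPaths_eq (n : ℕ) : motzkinPaths n = pathsTo n 0 := by
  simp [motzkinPaths, pathsTo]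

/-- The total weight of the paths of width `n` from the origin to height `y` which stay above the
axis, when a move `x` of height `h` has weight `g x h`, by recursion on the last move. -/
def transfer {R : Type*} [CommSemiring R] (g : Move → ℕ → R) : ℕ → ℕ → R
  | 0, y => if y = 0 then 1 else 0
  | n + 1, 0 => transfer g n 0 * g .flat 0 + transfer g n 1 * g .down 1
  | n + 1, y + 1 => transfer g n (y + 1) * g .flat (y + 1) + transfer g n y * g .up (y + 1) +
      transfer g n (y + 2) * g .down (y + 2)

theorem snoc_mem_pathsTo (mz : Fin n → Move) (x : Move) (y : ℕ) :
    (Fin.snoc mz x : Fin (n + 1) → Move) ∈ pathsTo (n + 1) y ↔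
      (∀ i : Fin (n + 1), 0 ≤ heightAt mz i.val) ∧ heightAt mz n + x.step = y := by
  have hlast : heightAt (Fin.snoc mz x : Fin (n + 1) → Move) (n + 1) =
      heightAt mz n + x.step := by
    rw [heightAt_snoc, if_pos (by omega)]
    congr 1
    exact Finset.sum_congr rfl fun j _ => by rw [if_pos (by omega), if_pos (by omega)]
  have hinit : ∀ i : Fin (n + 1), heightAt (Fin.snoc mz x : Fin (n + 1) → Move) i.val =
      heightAt mz i.val := fun i => by
    rw [heightAt_snoc, if_neg (by omega), add_zero]
  rw [pathsTo, Finset.mem_filter, Fin.forall_fin_succ']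
  simp only [Finset.mem_univ, true_and, Fin.val_castSucc, Fin.val_last, hinit, hlast]
  constructor
  · rintro ⟨⟨h, -⟩, h'⟩
    exact ⟨h, h'⟩
  · rintro ⟨h, h'⟩
    exact ⟨⟨h, by omega⟩, h'⟩

theorem moveHeight_snoc_castSucc (mz : Fin n → Move) (x : Move) (j : Fin n) :
    moveHeight (Fin.snoc mz x : Fin (n + 1) → Move) j.castSucc = moveHeight mz j := by
  simp only [moveHeight, heightAt_snoc, Fin.val_castSucc]
  rw [if_neg (by omega), if_neg (by omega), add_zero, add_zero]

theorem moveHeight_snoc_last (mz : Fin n → Move) (x : Move) :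
    moveHeight (Fin.snoc mz x : Fin (n + 1) → Move) (Fin.last n) =
      (max (heightAt mz n) (heightAt mz n + x.step)).toNat := by
  have h := heightAt_succ (Fin.snoc mz x : Fin (n + 1) → Move) (Fin.last n)
  rw [Fin.snoc_last, Fin.val_last] at h
  have h' : heightAt (Fin.snoc mz x : Fin (n + 1) → Move) n = heightAt mz n := by
    rw [heightAt_snoc, if_neg (by omega), add_zero]
  rw [moveHeight, Fin.val_last, h, h']

/-- Deleting the last move leaves a path prefix whose moves keep their heights, so the product
splits off one factor. -/
theorem sum_pathsTo {R : Type*} [CommSemiring R] (g : Move → ℕ → R) (n y : ℕ) :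
    ∑ mz ∈ pathsTo n y, ∏ j, g (mz j) (moveHeight mz j) = transfer g n y := by
  induction n generalizing y with
  | zero =>
    rw [pathsTo, Finset.sum_filter, Fintype.sum_unique]
    simp [transfer, heightAt, eq_comm]
  | succ n ih =>
    -- The paths with last move `x` come from height `y'`, and that move has height `max y' y`.
    have step (x : Move) (y y' : ℕ) (h : (y' : ℤ) + x.step = y) :
        ∑ mz : Fin n → Move, (if (Fin.snoc mz x : Fin (n + 1) → Move) ∈ pathsTo (n + 1) y then
          ∏ j, g ((Fin.snoc mz x : Fin (n + 1) → Move) j)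
            (moveHeight (Fin.snoc mz x : Fin (n + 1) → Move) j) else 0) =
          transfer g n y' * g x (max y' y) := by
      rw [← ih, show pathsTo n y' = Finset.univ.filter _ from rfl, Finset.sum_filter,
        Finset.sum_mul]
      refine Finset.sum_congr rfl fun mz _ => ?_
      by_cases hmz : (∀ i : Fin (n + 1), 0 ≤ heightAt mz i.val) ∧ heightAt mz n = y'
      · rw [if_pos ((snoc_mem_pathsTo _ _ _).2 ⟨hmz.1, by omega⟩), if_pos hmz,
          Fin.prod_univ_castSucc]
        simp only [Fin.snoc_castSucc, Fin.snoc_last, moveHeight_snoc_castSucc,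
          moveHeight_snoc_last]
        rw [hmz.2, h, ← Nat.cast_max, Int.toNat_natCast]
      · rw [if_neg, if_neg hmz, zero_mul]
        rw [snoc_mem_pathsTo]
        rintro ⟨h1, h2⟩
        exact hmz ⟨h1, by omega⟩
    have huniv : (Finset.univ : Finset Move) = {.up, .flat, .down} := rfl
    have hite (s : Finset (Fin (n + 1) → Move)) (F : (Fin (n + 1) → Move) → R) :
        ∑ mz ∈ s, F mz = ∑ mz, if mz ∈ s then F mz else 0 := by simp
    rw [hite, ← (Fin.snocEquiv fun _ => Move).sum_comp, Fintype.sum_prod_type, huniv,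
      Finset.sum_insert (by simp), Finset.sum_insert (by simp), Finset.sum_singleton]
    simp only [Fin.snocEquiv_apply]
    cases y with
    | zero =>
      have h0 := step .flat 0 0 rfl
      have h1 := step .down 0 1 rfl
      -- An up move ending on the axis would start at height -1.
      have h2 : ∑ mz : Fin n → Move,
          (if (Fin.snoc mz Move.up : Fin (n + 1) → Move) ∈ pathsTo (n + 1) 0 then
            ∏ j, g ((Fin.snoc mz Move.up : Fin (n + 1) → Move) j)
              (moveHeight (Fin.snoc mz Move.up : Fin (n + 1) → Move) j) else 0) = 0 := by
        refine Finset.sum_eq_zero fun mz _ => if_neg ?_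
        rw [snoc_mem_pathsTo]
        rintro ⟨h1, h2⟩
        have := h1 (Fin.last n)
        simp only [Move.step, Fin.val_last] at h2 this
        omega
      refine (congrArg₂ (· + ·) h2 (congrArg₂ (· + ·) h0 h1)).trans ?_
      simp [transfer]
    | succ y =>
      have h0 := step .flat (y + 1) (y + 1) (by simp [Move.step])
      have h1 := step .down (y + 1) (y + 2) (by simp [Move.step]; ring)
      have h2 := step .up (y + 1) y (by simp [Move.step])
      refine (congrArg₂ (· + ·) h2 (congrArg₂ (· + ·) h0 h1)).trans ?_
      simp only [max_self, show max y (y + 1) = y + 1 by omega,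
        show max (y + 2) (y + 1) = y + 2 by omega, transfer]
      ring

/-! ### Area as a sum of heights, and weights that mark it -/

theorem heightAt_nonneg_of_mem {mz : Fin n → Move} {y : ℕ} (hmz : mz ∈ pathsTo n y) (j : Fin n) :
    0 ≤ heightAt mz j ∧ 0 ≤ heightAt mz (j + 1) := by
  have h := (Finset.mem_filter.1 hmz).2.1
  exact ⟨h j.castSucc, h j.succ⟩

/-- The sum of the heights after the moves of a path. -/
def heightSum (mz : Fin n → Move) : ℕ := ∑ j : Fin n, (heightAt mz (j + 1)).toNat

/-- Both ends of the path have height 0, so the heights before the moves and the heights after them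
have the same sum. -/
theorem twiceArea_eq {mz : Fin n → Move} (hmz : mz ∈ motzkinPaths n) :
    twiceArea mz = 2 * (heightSum mz : ℤ) := by
  have hmz' := hmz
  rw [motzkinPaths_eq] at hmz'
  have h1 : (heightSum mz : ℤ) = ∑ j : Fin n, heightAt mz (j + 1) := by
    rw [heightSum, Nat.cast_sum]
    exact Finset.sum_congr rfl fun j _ => Int.toNat_of_nonneg (heightAt_nonneg_of_mem hmz' j).2
  have h2 : ∑ j : Fin n, heightAt mz j = ∑ j : Fin n, heightAt mz (j + 1) := by
    rw [Fin.sum_univ_eq_sum_range (fun j => heightAt mz j) n,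
      Fin.sum_univ_eq_sum_range (fun j => heightAt mz (j + 1)) n]
    have h3 := Finset.sum_range_succ (fun j => heightAt mz j) n
    have h4 := Finset.sum_range_succ' (fun j => heightAt mz j) n
    have h5 : heightAt mz n = 0 := (Finset.mem_filter.1 hmz).2.2
    rw [heightAt_zero] at h4
    rw [h5] at h3
    linarith
  rw [twiceArea, Finset.sum_add_distrib, h2, h1]
  ring

/-- The weight of a move of height `h` in terms of a parameter `q` which marks the area below the
end of the move. -/
def moveWeight {R : Type*} [CommSemiring R] (q : R) : Move → ℕ → R
  | .up, h => (h : R) * q ^ h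
  | .flat, h => ((2 * h + 1 : ℕ) : R) * q ^ h
  | .down, h => (h : R) * q ^ (h - 1)

theorem moveWeight_eq {R : Type*} [CommSemiring R] (q : R) {mz : Fin n → Move} {y : ℕ}
    (hmz : mz ∈ pathsTo n y) (j : Fin n) :
    moveWeight q (mz j) (moveHeight mz j) =
      ((if mz j = Move.flat then 2 * moveHeight mz j + 1 else moveHeight mz j : ℕ) : R) *
        q ^ (heightAt mz (j + 1)).toNat := by
  obtain ⟨h1, h2⟩ := heightAt_nonneg_of_mem hmz j
  have h3 := heightAt_succ mz j
  cases hj : mz j <;> rw [hj] at h3 <;> simp only [Move.step] at h3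
  · rw [if_neg (by simp)]
    simp only [moveWeight, moveHeight]
    rw [show max (heightAt mz j) (heightAt mz (j + 1)) = heightAt mz (j + 1) by omega]
  · rw [if_pos rfl]
    simp only [moveWeight, moveHeight]
    rw [show max (heightAt mz j) (heightAt mz (j + 1)) = heightAt mz (j + 1) by omega]
  · rw [if_neg (by simp)]
    simp only [moveWeight, moveHeight]
    rw [show (max (heightAt mz j) (heightAt mz (j + 1))).toNat - 1 =
      (heightAt mz (j + 1)).toNat by omega]

theorem prod_moveWeight {R : Type*} [CommSemiring R] (q : R) {mz : Fin n → Move} {y : ℕ}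
    (hmz : mz ∈ pathsTo n y) :
    ∏ j, moveWeight q (mz j) (moveHeight mz j) = (weight mz : R) * q ^ heightSum mz := by
  rw [Finset.prod_congr rfl fun j _ => moveWeight_eq q hmz j, Finset.prod_mul_distrib,
    Finset.prod_pow_eq_pow_sum, weight, heightSum, Nat.cast_prod]

/-! ### The height of a path and the moves at a given height -/

theorem pathHeight_le_iff {mz : Fin n → Move} {h : ℕ} :
    pathHeight mz ≤ h ↔ ∀ i ≤ n, (heightAt mz i).toNat ≤ h := by
  simp [pathHeight, Finset.sup_le_iff]

theorem moveHeight_le_pathHeight (mz : Fin n → Move) (j : Fin n) :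
    moveHeight mz j ≤ pathHeight mz := by
  have h := pathHeight_le_iff.1 (le_refl (pathHeight mz))
  have h1 := h j (by omega)
  have h2 := h (j + 1) (by omega)
  rw [moveHeight]
  omega

theorem pathHeight_le (mz : Fin n → Move) : pathHeight mz ≤ n :=
  pathHeight_le_iff.2 fun i hi => by
    have := heightAt_le mz i hi
    omega

/-- The move that first takes the path above `h` is an up move from `h` to `h + 1`. This turns
statements about the height into statements about single moves. -/
theorem exists_up_of_lt_pathHeight {mz : Fin n → Move} {h : ℕ} (hh : h < pathHeight mz) :
    ∃ j, mz j = Move.up ∧ moveHeight mz j = h + 1 := by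
  have hex : ∃ i, i ≤ n ∧ h < (heightAt mz i).toNat := by
    by_contra! hcon
    exact absurd (pathHeight_le_iff.2 hcon) (by omega)
  classical
  obtain ⟨hi, hi'⟩ := Nat.find_spec hex
  have hmin := fun k => Nat.find_min hex (m := k)
  generalize Nat.find hex = i at *
  cases i with
  | zero => simp [heightAt_zero] at hi'
  | succ i =>
    have h1 := hmin i (by omega)
    have h2 := heightAt_succ mz ⟨i, hi⟩
    have h3 : ¬ h < (heightAt mz i).toNat := fun h' => h1 ⟨by omega, h'⟩
    refine ⟨⟨i, hi⟩, ?_, ?_⟩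
    · cases hj : mz ⟨i, hi⟩ <;> rw [hj] at h2 <;> simp only [Move.step] at h2 <;>
        first | rfl | omega
    · have h4 := step_le_one (mz ⟨i, hi⟩)
      simp only [moveHeight] at h2 ⊢
      omega

theorem pathHeight_le_iff_moves {mz : Fin n → Move} {h : ℕ} :
    pathHeight mz ≤ h ↔ ∀ j, moveHeight mz j ≤ h := by
  refine ⟨fun H j => (moveHeight_le_pathHeight mz j).trans H, fun H => ?_⟩
  by_contra! hlt
  obtain ⟨j, -, hj⟩ := exists_up_of_lt_pathHeight hlt
  have := H j
  omega

theorem le_pathHeight_of_peakCount {mz : Fin n → Move} {h : ℕ} (hp : peakCount mz h ≠ 0) :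
    h ≤ pathHeight mz := by
  obtain ⟨j, hj⟩ := Finset.card_ne_zero.1 hp
  rw [← (Finset.mem_filter.1 hj).2.2]
  exact moveHeight_le_pathHeight mz j

/-- A path reaching level `h + 1` has an up move there. The condition on flats is then automatic; it
is kept to match the conditions in the table. -/
theorem pathHeight_le_iff_counts {mz : Fin n → Move} {h : ℕ} :
    pathHeight mz ≤ h ↔
      pathHeight mz ≤ h + 1 ∧ peakCount mz (h + 1) = 0 ∧ flatCount mz (h + 1) = 0 := by
  constructor
  · intro H
    refine ⟨by omega, ?_, ?_⟩ <;>
    · refine Finset.card_eq_zero.2 (Finset.filter_eq_empty_iff.2 fun j _ hj => ?_)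
      have := moveHeight_le_pathHeight mz j
      omega
  · rintro ⟨-, H, -⟩
    by_contra! hlt
    obtain ⟨j, hj⟩ := exists_up_of_lt_pathHeight hlt
    exact Finset.notMem_empty j
      (Finset.card_eq_zero.1 H ▸ Finset.mem_filter.2 ⟨Finset.mem_univ j, hj⟩)

theorem heightSum_le (mz : Fin n → Move) : heightSum mz ≤ n ^ 2 := by
  have h : ∀ j ∈ (Finset.univ : Finset (Fin n)), (heightAt mz (j + 1)).toNat ≤ n := fun j _ =>
    (pathHeight_le_iff.1 (le_refl _) (j + 1) (by omega)).trans (pathHeight_le mz)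
  calc heightSum mz ≤ _ := Finset.sum_le_card_nsmul _ _ n h
    _ = n ^ 2 := by simp [sq]

/-! ### The table in terms of the transfer recursion -/

open Polynomial in
/-- The weight of a move below level `h` (or of a peak move at level `h`): the variable of the
coefficient ring marks the area, and the outer variable the up moves at level `h`. -/
noncomputable def levelWeight (h : ℕ) (x : Move) (y : ℕ) : ℕ[X][X] :=
  if y ≤ h ∧ ¬ (x = .flat ∧ y = h) then
    C (moveWeight X x y) * (if x = .up ∧ y = h then X else 1) else 0

/-- The total weight of the path prefixes of width `n` from the origin to height `y` of height at
most `h` without flats at height `h`, with `p` up moves of height `h` and heights of sum `a`. -/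
noncomputable def prefixWeight (h n a y p : ℕ) : ℕ :=
  ((transfer (levelWeight h) n y).coeff p).coeff a

open Polynomial in
-- One forbidden move makes the product vanish, so the factors act as an indicator of the admissible
-- paths.
theorem prod_levelWeight {mz : Fin n → Move} {y : ℕ} (hmz : mz ∈ pathsTo n y) (h : ℕ) :
    ∏ j, levelWeight h (mz j) (moveHeight mz j) =
      if pathHeight mz ≤ h ∧ flatCount mz h = 0 then
        C ((weight mz : ℕ[X]) * X ^ heightSum mz) * X ^ peakCount mz h else 0 := by
  have hiff : (pathHeight mz ≤ h ∧ flatCount mz h = 0) ↔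
      ∀ j, moveHeight mz j ≤ h ∧ ¬ (mz j = .flat ∧ moveHeight mz j = h) := by
    rw [forall_and, pathHeight_le_iff_moves, flatCount, Finset.card_eq_zero,
      Finset.filter_eq_empty_iff]
    simp
  by_cases H : pathHeight mz ≤ h ∧ flatCount mz h = 0
  · rw [if_pos H, ← prod_moveWeight X hmz, map_prod, peakCount, Finset.card_filter]
    refine Eq.trans ?_ (congrArg _ (Finset.prod_pow_eq_pow_sum (M := ℕ[X][X]) _ _ _))
    rw [← Finset.prod_mul_distrib]
    refine Finset.prod_congr rfl fun j _ => ?_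
    rw [levelWeight, if_pos (hiff.1 H j), pow_ite, pow_one, pow_zero]
  · rw [if_neg H]
    rw [hiff] at H
    push Not at H
    obtain ⟨j, hj⟩ := H
    refine Finset.prod_eq_zero (M₀ := ℕ[X][X]) (Finset.mem_univ j) ?_
    rw [levelWeight]
    exact if_neg fun h' => h'.2 (hj h'.1)

open Polynomial in
theorem prefixWeight_eq_sum (h n d p : ℕ) :
    prefixWeight h n d 0 p = ∑ mz ∈ (motzkinPaths n).filter fun mz =>
      twiceArea mz = 2 * (d : ℤ) ∧ pathHeight mz ≤ h ∧
        peakCount mz h = p ∧ flatCount mz h = 0, weight mz := by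
  rw [prefixWeight, ← sum_pathsTo, finsetSum_coeff, finsetSum_coeff, Finset.sum_filter,
    motzkinPaths_eq]
  refine Finset.sum_congr rfl fun mz hmz => ?_
  rw [prod_levelWeight hmz, twiceArea_eq (motzkinPaths_eq n ▸ hmz)]
  by_cases H : pathHeight mz ≤ h ∧ flatCount mz h = 0
  · rw [if_pos H, coeff_C_mul, coeff_X_pow]
    by_cases hp : p = peakCount mz h
    · rw [if_pos hp, mul_one, ← C_eq_natCast, coeff_C_mul, coeff_X_pow]
      by_cases hd : d = heightSum mz
      · rw [if_pos hd, if_pos ⟨by omega, H.1, hp.symm, H.2⟩]; simp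
      · rw [if_neg hd, if_neg fun h' => hd (by omega), mul_zero]
    · rw [if_neg hp, if_neg fun h' => hp h'.2.2.1.symm]; simp
  · rw [if_neg H, if_neg fun h' => H ⟨h'.2.1, h'.2.2.2⟩]; simp

/-- A peak at level `h` forces height at least `h`, and for `h ≤ 1` the two permitted heights are
all heights up to `h`. Either way the condition on the topmost level only says that the height is at
most `h`. -/
theorem weightTable_eq_prefixWeight (n d h p : ℕ) (hp : p ≠ 0 ∨ h ≤ 1) :
    weightTable n d h p = prefixWeight h n d 0 p := by
  rw [prefixWeight_eq_sum, weightTable]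
  congr 1
  refine Finset.filter_congr fun mz _ => ?_
  refine and_congr_right fun _ => ?_
  constructor
  · rintro ⟨h1, h2⟩
    exact ⟨by omega, h2⟩
  · rintro ⟨h1, h2⟩
    refine ⟨?_, h2⟩
    rcases hp with hp | hp
    · have := le_pathHeight_of_peakCount (h2.1.trans_ne hp)
      omega
    · omega

theorem heightMarginal_eq_sum (n d h : ℕ) :
    heightMarginal n d h = ∑ mz ∈ (motzkinPaths n).filter fun mz =>
      twiceArea mz = 2 * (d : ℤ) ∧ pathHeight mz = h, weight mz := by
  rw [heightMarginal, weightTable]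
  congr 1
  refine Finset.filter_congr fun mz _ => and_congr_right fun _ => ?_
  have := pathHeight_le_iff_counts (mz := mz) (h := h)
  constructor
  · rintro ⟨h1, h2⟩
    have := this.2 ⟨by omega, h2⟩
    omega
  · rintro rfl
    exact ⟨.inr rfl, (this.1 le_rfl).2⟩

/-- With the top level empty, the two prefix weights count paths of height at most `h` and at most
`h + 1`; the table value counts those of height exactly `h + 1`. -/
theorem weightTable_add_prefixWeight (n d h : ℕ) :
    weightTable n d (h + 2) 0 + prefixWeight (h + 1) n d 0 0 = prefixWeight (h + 2) n d 0 0 := by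
  have hm := heightMarginal_eq_sum n d (h + 1)
  rw [heightMarginal] at hm
  have key (h : ℕ) : prefixWeight (h + 1) n d 0 0 = ∑ mz ∈ (motzkinPaths n).filter fun mz =>
      twiceArea mz = 2 * (d : ℤ) ∧ pathHeight mz ≤ h, weight mz := by
    rw [prefixWeight_eq_sum]
    congr 1
    refine Finset.filter_congr fun mz _ => and_congr_right fun _ => ?_
    exact pathHeight_le_iff_counts.symm
  rw [hm, key h, key (h + 1), Finset.sum_filter, Finset.sum_filter, Finset.sum_filter,
    ← Finset.sum_add_distrib]
  refine Finset.sum_congr rfl fun mz _ => ?_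
  by_cases ha : twiceArea mz = 2 * (d : ℤ)
  · rcases lt_trichotomy (pathHeight mz) (h + 1) with hh | hh | hh
    · simp [ha, hh.ne, hh.le, Nat.lt_succ_iff.1 hh]
    · simp [ha, hh]
    · have h1 : ¬ pathHeight mz ≤ h + 1 := by omega
      have h2 : ¬ pathHeight mz ≤ h := by omega
      simp [h1, h2, hh.ne']
  · simp [ha]

/-- The truncated differences are indicators of `p = 0` and `2 ≤ h`, in a form the machine can
evaluate. -/
theorem weightTable_eq (n d h p : ℕ) : weightTable n d h p =
    prefixWeight h n d 0 p -
      (1 - p) * (1 - (2 - h)) * prefixWeight (h - 1) n d 0 0 := by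
  by_cases hp : p ≠ 0 ∨ h ≤ 1
  · rw [weightTable_eq_prefixWeight n d h p hp]
    rcases hp with hp | hp
    · simp [show 1 - p = 0 by omega]
    · simp [show 1 - (2 - h) = 0 by omega]
  · push Not at hp
    obtain ⟨rfl, hh⟩ := hp
    obtain ⟨k, rfl⟩ := Nat.exists_eq_add_of_le' hh
    have := weightTable_add_prefixWeight n d k
    simp only [show k + (1 + 1) - 1 = k + 1 by omega, show 2 - (k + (1 + 1)) = 0 by omega]
    simp only [show k + (1 + 1) = k + 2 by omega]
    omega

theorem totalMarginal_eq_sum (n d : ℕ) :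
    totalMarginal n d = ∑ mz ∈ (motzkinPaths n).filter fun mz =>
      twiceArea mz = 2 * (d : ℤ), weight mz := by
  simp only [totalMarginal, heightMarginal_eq_sum]
  rw [← Finset.sum_fiberwise_of_maps_to (t := Finset.range (n + 1)) (g := pathHeight)
    fun mz _ => Finset.mem_range.2 (Nat.lt_succ_of_le (pathHeight_le mz))]
  simp only [Finset.filter_filter]

open Polynomial in
-- The marker is `X ^ 2` because area `d` corresponds to displacement `2 * d`.
theorem totalMarginal_eq_coeff (n d : ℕ) :
    totalMarginal n d = (transfer (moveWeight (X ^ 2 : ℕ[X])) n 0).coeff (2 * d) := by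
  rw [totalMarginal_eq_sum, ← sum_pathsTo, finsetSum_coeff, Finset.sum_filter, motzkinPaths_eq]
  refine Finset.sum_congr rfl fun mz hmz => ?_
  rw [prod_moveWeight _ hmz, twiceArea_eq (motzkinPaths_eq n ▸ hmz), ← pow_mul, ← C_eq_natCast,
    coeff_C_mul, coeff_X_pow]
  by_cases hd : d = heightSum mz
  · subst hd; simp
  · rw [if_neg (by omega), if_neg (by omega), mul_zero]

/-! ### Range and number of the parameters -/

theorem mem_parameters_of_weightTable_ne_zero {N n d h p : ℕ} (hn : n ≤ N)
    (hne : weightTable n d h p ≠ 0) : (n, d, h, p) ∈ parameters N := by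
  obtain ⟨mz, hmz, -⟩ := Finset.exists_ne_zero_of_sum_ne_zero hne
  obtain ⟨hmz, ha, hh, hp, -⟩ := Finset.mem_filter.1 hmz
  rw [twiceArea_eq hmz] at ha
  have h1 := heightSum_le mz
  have h2 := pathHeight_le mz
  have h3 : peakCount mz h ≤ n := (Finset.card_le_univ _).trans (by simp)
  have h4 : n ^ 2 ≤ N ^ 2 := Nat.pow_le_pow_left hn 2
  simp only [parameters, Finset.mem_product, Finset.mem_range]
  omega

theorem card_parameters_le {N : ℕ} (hN : 1 ≤ N) : (parameters N).card ≤ 24 * N ^ 5 := by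
  simp only [parameters, Finset.card_product, Finset.card_range]
  have h1 : N ^ 2 + 1 ≤ 2 * N ^ 2 := by nlinarith
  calc (N + 1) * ((N ^ 2 + 1) * ((N + 2) * (N + 1)))
      ≤ (2 * N) * ((2 * N ^ 2) * ((3 * N) * (2 * N))) := by gcongr <;> omega
    _ = 24 * N ^ 5 := by ring

end Paths
end DisplacementTable

namespace DisplacementTable

/-! ### The displacement polynomial of the permutations -/

open Polynomial Equiv

/-- The weight of an arrow `j ↦ l`: its length in the inner variable, or (marked by the outer
variable) the distances of `j` and `l` from the left of the ground set. -/
noncomputable def arrowWeight (j l : ℕ) : ℕ[X][X] :=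
  C (X ^ ((j : ℤ) - l).natAbs) + C (X ^ (j + l + 2)) * X

/-- The generating polynomial of the permutations of `n` elements with a set of marked arrows. -/
noncomputable def arrowPoly (n : ℕ) : ℕ[X][X] :=
  ∑ π : Perm (Fin n), ∏ j : Fin n, arrowWeight j (π j)

/-- Shifting the ground set by one scales the outer variable. -/
theorem arrowWeight_succ_succ (j l : ℕ) :
    arrowWeight (j + 1) (l + 1) = (arrowWeight j l).comp (C (X ^ 2) * X) := by
  simp only [arrowWeight, add_comp, mul_comp, C_comp, X_comp]
  rw [← mul_assoc, ← C_mul, ← pow_add]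
  rw [show ((j + 1 : ℕ) : ℤ) - (l + 1 : ℕ) = (j : ℤ) - l by push_cast; ring,
    show j + 1 + (l + 1) + 2 = j + l + 2 + 2 by ring]

theorem arrowWeight_zero_zero : arrowWeight 0 0 = ((1 : ℕ[X][X]) + X).comp (C (X ^ 2) * X) := by
  simp [arrowWeight]

/-- Inserting a new leftmost point into `j ↦ l` produces two arrows whose lengths add up to `j + l +
2`, the exponent of the marked term, which the derivative extracts. Each new arrow also contributes
a factor 1 + Y, evaluated at X^2 Y. -/
theorem arrowWeight_succ_zero_mul (j l : ℕ) :
    arrowWeight (j + 1) 0 * arrowWeight 0 (l + 1) =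
      ((1 + X) ^ 2 * derivative (arrowWeight j l)).comp (C (X ^ 2) * X) := by
  simp only [arrowWeight, derivative_add, derivative_mul, derivative_C, derivative_X, add_comp,
    mul_comp, C_comp, X_comp, pow_comp, one_comp, zero_mul, zero_add, mul_one]
  have h1 : ((j + 1 : ℕ) - (0 : ℕ) : ℤ).natAbs = j + 1 := by omega
  have h2 : ((0 : ℕ) - (l + 1 : ℕ) : ℤ).natAbs = l + 1 := by omega
  rw [h1, h2]
  simp only [C_pow]
  ring

theorem prod_decomposeFin_zero {n : ℕ} (e : Perm (Fin n)) :
    ∏ j, arrowWeight (j : Fin (n + 1)) (Perm.decomposeFin.symm (0, e) j) =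
      ((1 + X) * ∏ j : Fin n, arrowWeight j (e j)).comp (C (X ^ 2) * X) := by
  rw [Fin.prod_univ_succ, mul_comp, Polynomial.prod_comp]
  simp only [Perm.decomposeFin_symm_apply_zero, Perm.decomposeFin_symm_apply_succ, swap_self,
    refl_apply, Fin.val_succ, Fin.val_zero, arrowWeight_succ_succ, arrowWeight_zero_zero]

/-- Here 0 is inserted into the arrow that leaves `i`; all other arrows are only shifted. -/
theorem prod_decomposeFin_succ {n : ℕ} (e : Perm (Fin n)) (i : Fin n) :
    ∏ j, arrowWeight (j : Fin (n + 1)) (Perm.decomposeFin.symm ((e i).succ, e) j) =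
      ((1 + X) ^ 2 * ((∏ j ∈ Finset.univ.erase i, arrowWeight j (e j)) *
        derivative (arrowWeight i (e i)))).comp (C (X ^ 2) * X) := by
  rw [Fin.prod_univ_succ, ← Finset.mul_prod_erase Finset.univ _ (Finset.mem_univ i), ← mul_assoc,
    mul_comm (∏ j ∈ Finset.univ.erase i, arrowWeight j (e j)), ← mul_assoc, mul_comp,
    Polynomial.prod_comp, ← arrowWeight_succ_zero_mul]
  refine congrArg₂ (· * ·) ?_ ?_
  · refine (mul_comm (G := ℕ[X][X]) _ _).trans ?_
    simp [Perm.decomposeFin_symm_apply_succ]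
  · refine Finset.prod_congr rfl fun j hj => ?_
    have hj' : j ≠ i := Finset.ne_of_mem_erase hj
    rw [Perm.decomposeFin_symm_apply_succ, swap_apply_of_ne_of_ne (Fin.succ_ne_zero _)
      (by simpa using hj'), ← arrowWeight_succ_succ, Fin.val_succ, Fin.val_succ]

theorem arrowPoly_succ (n : ℕ) : arrowPoly (n + 1) =
    ((1 + X) * arrowPoly n + (1 + X) ^ 2 * derivative (arrowPoly n)).comp (C (X ^ 2) * X) := by
  rw [arrowPoly, ← Perm.decomposeFin.symm.sum_comp, Fintype.sum_prod_type_right, arrowPoly,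
    derivative_sum, Finset.mul_sum, Finset.mul_sum, ← Finset.sum_add_distrib, Polynomial.sum_comp]
  refine Finset.sum_congr rfl fun e _ => ?_
  -- Reindexing by `e` names the image of 0 by the arrow it interrupts, so that the sum over `i` is
  -- the Leibniz rule.
  rw [Fin.sum_univ_succ, ← Equiv.sum_comp e, add_comp, prod_decomposeFin_zero, derivative_prod_finset,
    Finset.mul_sum, Polynomial.sum_comp]
  simp only [prod_decomposeFin_succ]

/-- With a_k the coefficients for `n`, the next one is X^(2k) ((2k+1) a_k + k a_{k-1} + (k+1)
a_{k+1}): the flat, up and down moves that end at height k. -/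
theorem coeff_arrowPoly (n k : ℕ) :
    (arrowPoly n).coeff k = transfer (moveWeight (X ^ 2 : ℕ[X])) n k := by
  induction n generalizing k with
  | zero => simp [arrowPoly, transfer, coeff_one]
  | succ n ih =>
    rw [arrowPoly_succ, comp_C_mul_X_coeff]
    have hsq : (1 + X : ℕ[X][X]) ^ 2 * derivative (arrowPoly n) =
        derivative (arrowPoly n) + 2 * (derivative (arrowPoly n) * X) +
          derivative (arrowPoly n) * X ^ 2 := by ring
    rw [hsq, add_mul, one_mul, mul_comm (X : ℕ[X][X]), two_mul]
    rcases k with _ | _ | k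
    · simp [transfer, coeff_derivative, ih, moveWeight]
    · simp [transfer, coeff_derivative, ih, coeff_mul_X_pow', moveWeight]
      ring
    · simp [transfer, coeff_derivative, ih, coeff_mul_X_pow', moveWeight]
      ring

theorem coeff_zero_arrowPoly (n : ℕ) :
    (arrowPoly n).coeff 0 = ∑ π : Perm (Fin n), X ^ (displacement π).toNat := by
  rw [arrowPoly, finsetSum_coeff]
  refine Finset.sum_congr rfl fun π _ => ?_
  rw [coeff_zero_prod]
  have h (j : Fin n) : (arrowWeight j (π j)).coeff 0 =
      (X ^ ((j : ℤ) - (π j : ℕ)).natAbs : ℕ[X]) := by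
    rw [arrowWeight, coeff_add, coeff_C_zero, mul_coeff_zero, coeff_X_zero, mul_zero, add_zero]
  simp only [h, Finset.prod_pow_eq_pow_sum]
  congr 1
  rw [displacement]
  simp only [Int.abs_eq_natAbs, ← Nat.cast_sum, Int.toNat_natCast]

theorem totalMarginal_eq_displacementNumber (n d : ℕ) :
    totalMarginal n d = displacementNumber n d := by
  rw [totalMarginal_eq_coeff, ← coeff_arrowPoly, coeff_zero_arrowPoly, finsetSum_coeff,
    displacementNumber, Finset.card_filter]
  refine Finset.sum_congr rfl fun π _ => ?_
  have h : 0 ≤ displacement π := Finset.sum_nonneg fun _ _ => abs_nonneg _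
  rw [coeff_X_pow]
  exact if_congr (by omega) rfl rfl

end DisplacementTable

namespace DisplacementTable

/-! ### Filling an array in row-major order -/

/-- The row-major index of `(i₁, i₂, i₃, i₄, i₅)` in a box with sides `_, B₂, B₃, B₄, B₅`. -/
def index (B₂ B₃ B₄ B₅ i₁ i₂ i₃ i₄ i₅ : ℕ) : ℕ :=
  (((i₁ * B₂ + i₂) * B₃ + i₃) * B₄ + i₄) * B₅ + i₅

/-- The values of `F` listed in row-major order. -/
def flatten (B₂ B₃ B₄ B₅ : ℕ) (F : ℕ → ℕ → ℕ → ℕ → ℕ → ℕ) (k : ℕ) : ℕ :=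
  F (k / B₅ / B₄ / B₃ / B₂) (k / B₅ / B₄ / B₃ % B₂) (k / B₅ / B₄ % B₃) (k / B₅ % B₄) (k % B₅)

theorem flatten_index {B₂ B₃ B₄ B₅ i₂ i₃ i₄ i₅ : ℕ} (F : ℕ → ℕ → ℕ → ℕ → ℕ → ℕ) (i₁ : ℕ)
    (h₂ : i₂ < B₂) (h₃ : i₃ < B₃) (h₄ : i₄ < B₄) (h₅ : i₅ < B₅) :
    flatten B₂ B₃ B₄ B₅ F (index B₂ B₃ B₄ B₅ i₁ i₂ i₃ i₄ i₅) = F i₁ i₂ i₃ i₄ i₅ := by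
  have hdiv {b q r : ℕ} (h : r < b) : (q * b + r) / b = q := by
    rw [mul_comm, Nat.mul_add_div (by omega), Nat.div_eq_of_lt h, add_zero]
  have hmod {b q r : ℕ} (h : r < b) : (q * b + r) % b = r := by
    rw [mul_comm, Nat.mul_add_mod, Nat.mod_eq_of_lt h]
  simp only [flatten, index, hdiv h₅, hmod h₅, hdiv h₄, hmod h₄, hdiv h₃, hmod h₃, hdiv h₂,
    hmod h₂]

theorem mul_add_lt_mul_add {b q q' r : ℕ} (h : q < q') (hr : r < b) (r' : ℕ) :
    q * b + r < q' * b + r' := by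
  have : (q + 1) * b ≤ q' * b := Nat.mul_le_mul_right b h
  linarith

theorem index_lt_mul {B₁ B₂ B₃ B₄ B₅ i₁ i₂ i₃ i₄ i₅ : ℕ} (h₁ : i₁ < B₁)
    (h₂ : i₂ < B₂) (h₃ : i₃ < B₃) (h₄ : i₄ < B₄) (h₅ : i₅ < B₅) :
    index B₂ B₃ B₄ B₅ i₁ i₂ i₃ i₄ i₅ < B₁ * B₂ * B₃ * B₄ * B₅ :=
  mul_add_lt_mul_add (mul_add_lt_mul_add (mul_add_lt_mul_add (mul_add_lt_mul_add h₁ h₂ 0)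
    h₃ 0) h₄ 0) h₅ 0

theorem index_lt_index_of_second_lt {B₂ B₃ B₄ B₅ i₂ i₂' i₃ i₄ i₅ : ℕ} (i₁ : ℕ) (h₂ : i₂ < i₂')
    (h₃ : i₃ < B₃) (h₄ : i₄ < B₄) (h₅ : i₅ < B₅) (i₃' i₄' i₅' : ℕ) :
    index B₂ B₃ B₄ B₅ i₁ i₂ i₃ i₄ i₅ < index B₂ B₃ B₄ B₅ i₁ i₂' i₃' i₄' i₅' :=
  mul_add_lt_mul_add (mul_add_lt_mul_add (mul_add_lt_mul_add (by omega) h₃ _) h₄ _) h₅ _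

/-- The array `a` holds the values of `F` on a box, in row-major order. -/
def HasTable (a B₁ B₂ B₃ B₄ B₅ : ℕ) (F : ℕ → ℕ → ℕ → ℕ → ℕ → ℕ) (σ : Memory) : Prop :=
  ∀ i₁ < B₁, ∀ i₂ < B₂, ∀ i₃ < B₃, ∀ i₄ < B₄, ∀ i₅ < B₅,
    σ.arr a (index B₂ B₃ B₄ B₅ i₁ i₂ i₃ i₄ i₅) = F i₁ i₂ i₃ i₄ i₅

/-- `P` depends only on register `0` and on the arrays other than `a`. -/
def Stable (a : ℕ) (P : Memory → Prop) : Prop :=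
  ∀ σ τ : Memory, P σ → τ.reg 0 = σ.reg 0 → (∀ b ≠ a, τ.arr b = σ.arr b) → P τ

theorem Stable.and {a : ℕ} {P Q : Memory → Prop} (hP : Stable a P) (hQ : Stable a Q) :
    Stable a (fun σ => P σ ∧ Q σ) :=
  fun σ τ h h0 ha => ⟨hP σ τ h.1 h0 ha, hQ σ τ h.2 h0 ha⟩

theorem stable_reg (a N : ℕ) : Stable a (fun σ => σ.reg 0 = N) := fun _ _ h h0 _ => h0.trans h

theorem stable_hasTable {a b : ℕ} (h : b ≠ a) (B₁ B₂ B₃ B₄ B₅ : ℕ)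
    (F : ℕ → ℕ → ℕ → ℕ → ℕ → ℕ) : Stable a (HasTable b B₁ B₂ B₃ B₄ B₅ F) :=
  fun σ τ hσ _ ha => by rw [HasTable, ha b h]; exact hσ

theorem Stable.setReg {a x : ℕ} {P : Memory → Prop} (hP : Stable a P) (hx : x ≠ 0) {σ : Memory}
    (h : P σ) (v : ℕ) : P (σ.setReg x v) :=
  hP σ _ h (reg_setReg_of_ne _ _ hx.symm) fun _ _ => rfl

/-- The condition `P`, and the first `k` cells of the array `a` are those of `G`. -/
def Filling (P : Memory → Prop) (a : ℕ) (G : ℕ → ℕ) (k : ℕ) (σ : Memory) : Prop :=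
  P σ ∧ ∀ j < k, σ.arr a j = G j

/-- Progress through a nest of loops is a single number, the length of the filled initial segment;
one round adds `len`, the volume of the inner box. `Q` carries the values of the outer loop
variables. -/
theorem Filling.for {P Q : Memory → Prop} {a x B c : ℕ} {G : ℕ → ℕ} {b : Expr} {s : Stmt}
    (hP : Stable a P) (hx : x ≠ 0) (hQ : ∀ σ v, Q σ → Q (σ.setReg x v))
    (hb : ∀ σ, P σ → b.eval σ = B) (start len : ℕ)
    (hs : ∀ i < B, Triple (fun σ => Filling P a G (start + i * len) σ ∧ Q σ ∧ σ.reg x = i) s c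
      (fun σ => Filling P a G (start + (i + 1) * len) σ ∧ Q σ ∧ σ.reg x = i)) :
    Triple (fun σ => Filling P a G start σ ∧ Q σ) (Stmt.for x b s) (b.cost + B * (c + 5) + 2)
      (fun σ => Filling P a G (start + B * len) σ ∧ Q σ) := by
  have h := Triple.for (x := x) (B := B) (b := b) (s := s) (c := c)
    (I := fun i σ => Filling P a G (start + i * len) σ ∧ Q σ)
    (fun σ hσ => hb σ hσ.1.1) fun i hi => (hs i hi).mono ?_ le_rfl fun σ hσ => ⟨hσ.1, hσ.2.1⟩
  · simpa using h
  · rintro _ ⟨τ, hτ, rfl⟩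
    exact ⟨⟨hP.setReg hx hτ.1.1 i, hτ.1.2⟩, hQ _ _ hτ.2, reg_setReg_self _ _ _⟩

/-- The expression for a row-major index. -/
def indexExpr (b₂ b₃ b₄ b₅ e₁ e₂ e₃ e₄ e₅ : Expr) : Expr :=
  (((e₁ * b₂ + e₂) * b₃ + e₃) * b₄ + e₄) * b₅ + e₅

theorem eval_indexExpr (σ : Memory) (b₂ b₃ b₄ b₅ e₁ e₂ e₃ e₄ e₅ : Expr) :
    (indexExpr b₂ b₃ b₄ b₅ e₁ e₂ e₃ e₄ e₅).eval σ =
      index (b₂.eval σ) (b₃.eval σ) (b₄.eval σ) (b₅.eval σ) (e₁.eval σ) (e₂.eval σ) (e₃.eval σ)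
        (e₄.eval σ) (e₅.eval σ) := rfl

/-- Fill the array `a` with the values of `e`, for the variables `1, …, 5` in a box with sides
`b₁, …, b₅`. -/
def fill (a : ℕ) (b₁ b₂ b₃ b₄ b₅ e : Expr) : Stmt :=
  .for 1 b₁ (.for 2 b₂ (.for 3 b₃ (.for 4 b₄ (.for 5 b₅ (.store a
    (indexExpr b₂ b₃ b₄ b₅ (.var 1) (.var 2) (.var 3) (.var 4) (.var 5)) e)))))

/-- A bound for the number of steps of `fill`. -/
def fillCost (b₁ b₂ b₃ b₄ b₅ e : Expr) (B₁ B₂ B₃ B₄ B₅ : ℕ) : ℕ :=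
  b₁.cost + B₁ * (b₂.cost + B₂ * (b₃.cost + B₃ * (b₄.cost + B₄ * (b₅.cost + B₅ *
    ((indexExpr b₂ b₃ b₄ b₅ (.var 1) (.var 2) (.var 3) (.var 4) (.var 5)).cost + (e.cost + 1) + 5)
      + 2 + 5) + 2 + 5) + 2 + 5) + 2 + 5) + 2

/-- Cells are written in the order of their row-major index, so `he` is one step of a strong
recursion along that index: the array may be read while it is being filled. -/
theorem fill_triple {P : Memory → Prop} {a B₁ B₂ B₃ B₄ B₅ : ℕ} {b₁ b₂ b₃ b₄ b₅ e : Expr}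
    {F : ℕ → ℕ → ℕ → ℕ → ℕ → ℕ} (hP : Stable a P)
    (hb₁ : ∀ σ, P σ → b₁.eval σ = B₁) (hb₂ : ∀ σ, P σ → b₂.eval σ = B₂)
    (hb₃ : ∀ σ, P σ → b₃.eval σ = B₃) (hb₄ : ∀ σ, P σ → b₄.eval σ = B₄)
    (hb₅ : ∀ σ, P σ → b₅.eval σ = B₅)
    (he : ∀ σ, P σ → ∀ i₁ < B₁, ∀ i₂ < B₂, ∀ i₃ < B₃, ∀ i₄ < B₄, ∀ i₅ < B₅,
      σ.reg 1 = i₁ → σ.reg 2 = i₂ → σ.reg 3 = i₃ → σ.reg 4 = i₄ → σ.reg 5 = i₅ →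
      (∀ j₁ j₂ j₃ j₄ j₅, j₂ < B₂ → j₃ < B₃ → j₄ < B₄ → j₅ < B₅ →
        index B₂ B₃ B₄ B₅ j₁ j₂ j₃ j₄ j₅ < index B₂ B₃ B₄ B₅ i₁ i₂ i₃ i₄ i₅ →
        σ.arr a (index B₂ B₃ B₄ B₅ j₁ j₂ j₃ j₄ j₅) = F j₁ j₂ j₃ j₄ j₅) →
      e.eval σ = F i₁ i₂ i₃ i₄ i₅) :
    Triple P (fill a b₁ b₂ b₃ b₄ b₅ e) (fillCost b₁ b₂ b₃ b₄ b₅ e B₁ B₂ B₃ B₄ B₅)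
      (fun σ => P σ ∧ HasTable a B₁ B₂ B₃ B₄ B₅ F σ) := by
  set G := flatten B₂ B₃ B₄ B₅ F with hG
  have key : Triple (fun σ => Filling P a G 0 σ ∧ True) (fill a b₁ b₂ b₃ b₄ b₅ e)
      (fillCost b₁ b₂ b₃ b₄ b₅ e B₁ B₂ B₃ B₄ B₅)
      (fun σ => Filling P a G (0 + B₁ * (B₂ * (B₃ * (B₄ * (B₅ * 1))))) σ ∧ True) := by
    refine Filling.for hP (by norm_num) (fun _ _ _ => trivial) hb₁ _ _ fun i₁ hi₁ => ?_
    refine (Filling.for (len := B₃ * (B₄ * (B₅ * 1))) (start := 0 + i₁ * (B₂ * (B₃ * (B₄ * (B₅ * 1)))))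
      hP (by norm_num) (fun σ v h => ?_) hb₂ fun i₂ hi₂ => ?_).mono (fun _ h => h) le_rfl
      (fun _ h => by rw [add_one_mul, ← add_assoc]; exact h)
    · simpa [reg_setReg_of_ne] using h
    refine (Filling.for (len := B₄ * (B₅ * 1)) (start := 0 + i₁ * (B₂ * (B₃ * (B₄ * (B₅ * 1)))) +
      i₂ * (B₃ * (B₄ * (B₅ * 1))))
      hP (by norm_num) (fun σ v h => ?_) hb₃ fun i₃ hi₃ => ?_).mono (fun _ h => h) le_rfl
      (fun _ h => by rw [add_one_mul, ← add_assoc]; exact h)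
    · simpa [reg_setReg_of_ne] using h
    refine (Filling.for (len := B₅ * 1) (start := 0 + i₁ * (B₂ * (B₃ * (B₄ * (B₅ * 1)))) +
      i₂ * (B₃ * (B₄ * (B₅ * 1))) + i₃ * (B₄ * (B₅ * 1)))
      hP (by norm_num) (fun σ v h => ?_) hb₄ fun i₄ hi₄ => ?_).mono (fun _ h => h) le_rfl
      (fun _ h => by rw [add_one_mul, ← add_assoc]; exact h)
    · simpa [reg_setReg_of_ne] using h
    refine (Filling.for (len := 1) (start := 0 + i₁ * (B₂ * (B₃ * (B₄ * (B₅ * 1)))) +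
      i₂ * (B₃ * (B₄ * (B₅ * 1))) + i₃ * (B₄ * (B₅ * 1)) + i₄ * (B₅ * 1))
      hP (by norm_num) (fun σ v h => ?_) hb₅ fun i₅ hi₅ => ?_).mono (fun _ h => h) le_rfl
      (fun _ h => by rw [add_one_mul, ← add_assoc]; exact h)
    · simpa [reg_setReg_of_ne] using h
    refine Triple.store ?_
    rintro σ ⟨⟨hPσ, hfill⟩, ⟨⟨⟨⟨-, r₁⟩, r₂⟩, r₃⟩, r₄⟩, r₅⟩
    have hidx : (indexExpr b₂ b₃ b₄ b₅ (.var 1) (.var 2) (.var 3) (.var 4) (.var 5)).eval σ =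
        index B₂ B₃ B₄ B₅ i₁ i₂ i₃ i₄ i₅ := by
      rw [eval_indexExpr, hb₂ σ hPσ, hb₃ σ hPσ, hb₄ σ hPσ, hb₅ σ hPσ]
      simp only [Expr.eval_var, r₁, r₂, r₃, r₄, r₅]
    -- The progress accumulated by the five loops is the index of the current cell.
    have hlin : 0 + i₁ * (B₂ * (B₃ * (B₄ * (B₅ * 1)))) + i₂ * (B₃ * (B₄ * (B₅ * 1))) +
        i₃ * (B₄ * (B₅ * 1)) + i₄ * (B₅ * 1) + i₅ * 1 = index B₂ B₃ B₄ B₅ i₁ i₂ i₃ i₄ i₅ := by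
      rw [index]; ring
    rw [hlin] at hfill
    have hval := he σ hPσ i₁ hi₁ i₂ hi₂ i₃ hi₃ i₄ hi₄ i₅ hi₅ r₁ r₂ r₃ r₄ r₅
      fun j₁ j₂ j₃ j₄ j₅ h₂ h₃ h₄ h₅ hlt => by
        rw [hfill _ hlt, hG, flatten_index F j₁ h₂ h₃ h₄ h₅]
    rw [add_one_mul, ← add_assoc, hlin, hidx, hval]
    refine ⟨⟨hP σ _ hPσ rfl fun b hb => ?_, fun j hj => ?_⟩, ⟨⟨⟨⟨trivial, r₁⟩, r₂⟩, r₃⟩, r₄⟩, r₅⟩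
    · exact Function.update_of_ne hb _ _
    · simp only [Memory.setArr, Function.update_self]
      rcases Nat.lt_succ_iff_lt_or_eq.1 hj with hj | rfl
      · rw [Function.update_of_ne hj.ne, hfill j hj]
      · rw [Function.update_self, hG, flatten_index F i₁ hi₂ hi₃ hi₄ hi₅]
  refine key.mono (fun σ hσ => ⟨⟨hσ, fun j hj => absurd hj (Nat.not_lt_zero j)⟩, trivial⟩) le_rfl ?_
  rintro σ ⟨⟨hPσ, hfill⟩, -⟩
  refine ⟨hPσ, fun i₁ h₁ i₂ h₂ i₃ h₃ i₄ h₄ i₅ h₅ => ?_⟩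
  rw [hfill, hG, flatten_index F i₁ h₂ h₃ h₄ h₅]
  exact (index_lt_mul h₁ h₂ h₃ h₄ h₅).trans_eq (by ring)

/-! ### Polynomially bounded costs -/

/-- `f` is bounded by a multiple of `N ^ k` on the positive integers. -/
def PolyBounded (k : ℕ) (f : ℕ → ℕ) : Prop := ∃ C, ∀ N, 1 ≤ N → f N ≤ C * N ^ k

theorem PolyBounded.const (c k : ℕ) : PolyBounded k fun _ => c :=
  ⟨c, fun _ hN => Nat.le_mul_of_pos_right c (Nat.pow_pos hN)⟩

theorem PolyBounded.add {k : ℕ} {f g : ℕ → ℕ} (hf : PolyBounded k f) (hg : PolyBounded k g) :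
    PolyBounded k fun N => f N + g N := by
  obtain ⟨C, hC⟩ := hf
  obtain ⟨D, hD⟩ := hg
  exact ⟨C + D, fun N hN => by rw [add_mul]; exact add_le_add (hC N hN) (hD N hN)⟩

theorem PolyBounded.mul {k l : ℕ} {f g : ℕ → ℕ} (hf : PolyBounded k f) (hg : PolyBounded l g) :
    PolyBounded (k + l) fun N => f N * g N := by
  obtain ⟨C, hC⟩ := hf
  obtain ⟨D, hD⟩ := hg
  exact ⟨C * D, fun N hN => (Nat.mul_le_mul (hC N hN) (hD N hN)).trans_eq (by rw [pow_add]; ring)⟩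

theorem PolyBounded.mono {k l : ℕ} {f : ℕ → ℕ} (hf : PolyBounded k f) (h : k ≤ l) :
    PolyBounded l f := by
  obtain ⟨C, hC⟩ := hf
  exact ⟨C, fun N hN => (hC N hN).trans (Nat.mul_le_mul_left C (Nat.pow_le_pow_right hN h))⟩

theorem PolyBounded.self : PolyBounded 1 fun N => N := ⟨1, fun N _ => by simp⟩

theorem PolyBounded.fillCost {k₁ k₂ k₃ k₄ k₅ : ℕ} {f₁ f₂ f₃ f₄ f₅ : ℕ → ℕ}
    (h₁ : PolyBounded k₁ f₁) (h₂ : PolyBounded k₂ f₂) (h₃ : PolyBounded k₃ f₃)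
    (h₄ : PolyBounded k₄ f₄) (h₅ : PolyBounded k₅ f₅) (b₁ b₂ b₃ b₄ b₅ e : Expr) :
    PolyBounded (k₁ + (k₂ + (k₃ + (k₄ + (k₅ + 0))))) fun N =>
      fillCost b₁ b₂ b₃ b₄ b₅ e (f₁ N) (f₂ N) (f₃ N) (f₄ N) (f₅ N) := by
  have step {k l : ℕ} {f g : ℕ → ℕ} (hf : PolyBounded k f) (hg : PolyBounded l g) (c : ℕ) :
      PolyBounded (k + l) fun N => c + f N * (g N + 5) + 2 :=
    ((const c _).add (hf.mul (hg.add (const 5 _)))).add (const 2 _)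
  exact step h₁ (step h₂ (step h₃ (step h₄ (step h₅ (const _ 0) _) _) _) _) _

end DisplacementTable

namespace DisplacementTable

/-! ### The recursion for the prefix weights -/

open Polynomial in
theorem coeff_mul_C_natCast_mul_X_pow (P : ℕ[X][X]) (c k a p : ℕ) :
    ((P * C ((c : ℕ[X]) * X ^ k)).coeff p).coeff a =
      if k ≤ a then c * (P.coeff p).coeff (a - k) else 0 := by
  rw [coeff_mul_C, ← mul_assoc, coeff_mul_X_pow', ← C_eq_natCast, coeff_mul_C]
  simp [mul_comm]

theorem prefixWeight_zero (h a y p : ℕ) :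
    prefixWeight h 0 a y p = (1 - a) * ((1 - y) * (1 - p)) := by
  rcases y with _ | y <;> rcases p with _ | p <;> rcases a with _ | a <;>
    simp [prefixWeight, transfer, Polynomial.coeff_one]

open Polynomial in
theorem prefixWeight_succ_of_lt {h y : ℕ} (hy : y < h) (n a p : ℕ) :
    prefixWeight h (n + 1) a y p = if y ≤ a then
      (2 * y + 1) * prefixWeight h n (a - y) y p +
        (y + 1) * prefixWeight h n (a - y) (y + 1) p +
        y * prefixWeight h n (a - y) (y - 1) p else 0 := by
  have hflat (z : ℕ) (hz : z < h) : levelWeight h .flat z = C (((2 * z + 1 : ℕ) : ℕ[X]) * X ^ z) := by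
    rw [levelWeight, if_pos ⟨hz.le, by simp [hz.ne]⟩, if_neg (by simp), mul_one, moveWeight]
  have hdown : levelWeight h .down (y + 1) = C (((y + 1 : ℕ) : ℕ[X]) * X ^ y) := by
    rw [levelWeight, if_pos ⟨hy, by simp⟩, if_neg (by simp), mul_one, moveWeight,
      Nat.add_sub_cancel]
  have hup (z : ℕ) (hz : z < h) : levelWeight h .up z = C ((z : ℕ[X]) * X ^ z) := by
    rw [levelWeight, if_pos ⟨hz.le, by simp⟩, if_neg (by simp [hz.ne]), mul_one, moveWeight]
  cases y with
  | zero =>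
    simp only [zero_add] at hdown
    rw [prefixWeight, transfer, hflat 0 hy, hdown]
    simp only [coeff_add, coeff_mul_C_natCast_mul_X_pow]
    simp [prefixWeight]
  | succ y =>
    rw [prefixWeight, transfer, hflat _ hy, hdown, hup _ hy]
    simp only [coeff_add, coeff_mul_C_natCast_mul_X_pow]
    split_ifs
    · simp only [prefixWeight, Nat.add_sub_cancel]; ring
    · rfl

open Polynomial in
-- At level `h` flats are forbidden and a down move would come from above, so only an up move can
-- end there. It is itself a peak, which lowers `p` and excludes `p = 0`.
theorem prefixWeight_succ_self (h n a p : ℕ) :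
    prefixWeight h (n + 1) a h p = if h ≤ a then
      (1 - (1 - p)) * (h * prefixWeight h n (a - h) (h - 1) (p - 1)) else 0 := by
  have hflat : levelWeight h .flat h = 0 := if_neg (by simp)
  have hdown : levelWeight h .down (h + 1) = 0 := if_neg (by simp)
  have hup : levelWeight h .up h = C ((h : ℕ[X]) * X ^ h) * X := by
    rw [levelWeight, if_pos (by simp), if_pos (by simp), moveWeight]
  cases h with
  | zero =>
    simp only [zero_add] at hdown
    rw [prefixWeight, transfer, hflat, hdown]
    simp
  | succ h =>
    rw [prefixWeight, transfer, hflat, hdown, hup, mul_zero, mul_zero, zero_add, add_zero,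
      ← mul_assoc]
    cases p with
    | zero => simp
    | succ p =>
      rw [coeff_mul_X, coeff_mul_C_natCast_mul_X_pow]
      simp [prefixWeight]

theorem prefixWeight_succ_of_gt {h y : ℕ} (hy : h < y) (n a p : ℕ) :
    prefixWeight h (n + 1) a y p = 0 := by
  have hlevel (x : Move) (z : ℕ) (hz : h < z) : levelWeight h x z = 0 :=
    if_neg fun h' => absurd h'.1 (by omega)
  obtain ⟨y, rfl⟩ := Nat.exists_eq_succ_of_ne_zero (show y ≠ 0 by omega)
  rw [prefixWeight, transfer, hlevel _ _ hy, hlevel _ _ hy, hlevel _ _ (by omega)]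
  simp

/-- The truncated differences are indicators of `y ≤ a`, `y < h`, `y = h` and `p ≠ 0`, which merge
all cases into one expression without comparisons. -/
theorem prefixWeight_succ (h n a y p : ℕ) : prefixWeight h (n + 1) a y p =
    (1 - (y - a)) * ((1 - (y + 1 - h)) * ((2 * y + 1) * prefixWeight h n (a - y) y p +
        (y + 1) * prefixWeight h n (a - y) (y + 1) p +
        y * prefixWeight h n (a - y) (y - 1) p) +
      (1 - ((y - h) + (h - y))) *
        ((1 - (1 - p)) * (y * prefixWeight h n (a - y) (y - 1) (p - 1)))) := by
  have hya : 1 - (y - a) = if y ≤ a then 1 else 0 := by split_ifs <;> omega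
  rw [hya]
  rcases lt_trichotomy y h with hy | rfl | hy
  · rw [prefixWeight_succ_of_lt hy, show 1 - (y + 1 - h) = 1 by omega,
      show 1 - ((y - h) + (h - y)) = 0 by omega]
    simp
  · rw [prefixWeight_succ_self, show 1 - (y + 1 - y) = 0 by omega,
      show 1 - ((y - y) + (y - y)) = 1 by omega]
    simp
  · rw [prefixWeight_succ_of_gt hy, show 1 - (y + 1 - h) = 0 by omega,
      show 1 - ((y - h) + (h - y)) = 0 by omega]
    simp

/-! ### The program -/

namespace Expr

/-- `N + 1`, with `N` in variable `0` -/
def widths : Expr := var 0 + const 1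
/-- `N + 2` -/
def levels : Expr := var 0 + const 2
/-- `N ^ 2 + 1` -/
def areas : Expr := var 0 * var 0 + const 1
/-- the constant `1` -/
def one : Expr := const 1

theorem eval_widths {σ : Memory} {N : ℕ} (h : σ.reg 0 = N) : widths.eval σ = N + 1 := by
  simp [widths, h]

theorem eval_levels {σ : Memory} {N : ℕ} (h : σ.reg 0 = N) : levels.eval σ = N + 2 := by
  simp [levels, h]

theorem eval_areas {σ : Memory} {N : ℕ} (h : σ.reg 0 = N) : areas.eval σ = N * N + 1 := by
  simp [areas, h]

/-- The cell `(h, n, a, y, p)` of the array of prefix weights. -/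
def prefixCell (h n a y p : Expr) : Expr :=
  load 3 (indexExpr widths areas levels widths h n a y p)

/-- The recursion for the prefix weight `(h, n, a, y, p)` in the variables `1, …, 5`. -/
def prefixValue : Expr :=
  (one - var 2) * ((one - var 3) * ((one - var 4) * (one - var 5))) +
  (one - (one - var 2)) * ((one - (var 4 - var 3)) *
    ((one - (var 4 + one - var 1)) *
        ((const 2 * var 4 + one) *
            prefixCell (var 1) (var 2 - one) (var 3 - var 4) (var 4) (var 5) +
          (var 4 + one) *
            prefixCell (var 1) (var 2 - one) (var 3 - var 4) (var 4 + one) (var 5) +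
          var 4 * prefixCell (var 1) (var 2 - one) (var 3 - var 4) (var 4 - one) (var 5)) +
      (one - ((var 4 - var 1) + (var 1 - var 4))) * ((one - (one - var 5)) *
        (var 4 *
          prefixCell (var 1) (var 2 - one) (var 3 - var 4) (var 4 - one) (var 5 - one)))))

/-- The table value `(n, d, h, p)` in the variables `2, …, 5`. -/
def tableValue : Expr :=
  prefixCell (var 4) (var 2) (var 3) (const 0) (var 5) -
    (one - var 5) * (one - (const 2 - var 4)) *
      prefixCell (var 4 - one) (var 2) (var 3) (const 0) (const 0)

/-- The marginal `(n, d, h)` in the variables `3, 4, 5`. -/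
def marginalValue : Expr :=
  load 0 (indexExpr widths areas levels widths (const 0) (var 3) (var 4) (var 5 + one) (const 0))

/-- The sum of the marginals `(n, d, h')` with `h' ≤ h`, for `(n, d, h)` in the variables
`3, 4, 5`. -/
def partialSumValue : Expr :=
  (one - (one - var 5)) * load 4
      (indexExpr one widths areas widths (const 0) (const 0) (var 3) (var 4) (var 5 - one)) +
    load 1 (indexExpr one widths areas widths (const 0) (const 0) (var 3) (var 4) (var 5))

/-- The total marginal `(n, d)` in the variables `4, 5`. -/
def totalValue : Expr :=
  load 4 (indexExpr one widths areas widths (const 0) (const 0) (var 4) (var 5) (var 4))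

end Expr

/-! ### Correctness of the five fills -/

open _root_.DisplacementTable.Expr

theorem fill_prefix {N : ℕ} {P : Memory → Prop} (hP : Stable 3 P)
    (hN : ∀ σ, P σ → σ.reg 0 = N) :
    Triple P (fill 3 levels widths areas levels widths prefixValue)
      (fillCost levels widths areas levels widths prefixValue
        (N + 2) (N + 1) (N * N + 1) (N + 2) (N + 1))
      (fun σ => P σ ∧ HasTable 3 (N + 2) (N + 1) (N * N + 1) (N + 2) (N + 1) prefixWeight σ) := by
  refine fill_triple hP (fun σ h => eval_levels (hN σ h)) (fun σ h => eval_widths (hN σ h))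
    (fun σ h => eval_areas (hN σ h)) (fun σ h => eval_levels (hN σ h))
    (fun σ h => eval_widths (hN σ h)) ?_
  intro σ h i₁ h₁ i₂ h₂ i₃ h₃ i₄ h₄ i₅ h₅ r₁ r₂ r₃ r₄ r₅ hrec
  simp only [prefixValue, prefixCell, one, eval_add, eval_sub, eval_mul, eval_const, eval_var,
    eval_load, eval_indexExpr, levels, widths, areas, hN σ h, r₁, r₂, r₃, r₄, r₅]
  cases i₂ with
  | zero => simp [prefixWeight_zero]
  | succ n =>
    have cell (y p : ℕ) (hy : y < N + 2) (hp : p < N + 1) :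
        σ.arr 3 (index (N + 1) (N * N + 1) (N + 2) (N + 1) i₁ n (i₃ - i₄) y p) =
          prefixWeight i₁ n (i₃ - i₄) y p :=
      hrec _ _ _ _ _ (by omega) (by omega) hy hp
        (index_lt_index_of_second_lt _ (by omega) (by omega) hy hp _ _ _)
    rw [prefixWeight_succ, Nat.add_sub_cancel, cell i₄ i₅ h₄ h₅,
      cell (i₄ - 1) i₅ (by omega) h₅, cell (i₄ - 1) (i₅ - 1) (by omega) (by omega)]
    -- For `y = N + 1` the cell at height `y + 1` lies outside the box. What is read there is
    -- multiplied by 0 unless `y < h`, and then `y + 1` is in range.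
    by_cases hlt : i₄ < i₁
    · rw [cell (i₄ + 1) i₅ (by omega) h₅]
      simp
    · rw [show 1 - (i₄ + 1 - i₁) = 0 by omega]
      simp

theorem fill_table {N : ℕ} {P : Memory → Prop} (hP : Stable 0 P) (hN : ∀ σ, P σ → σ.reg 0 = N)
    (hT : ∀ σ, P σ →
      HasTable 3 (N + 2) (N + 1) (N * N + 1) (N + 2) (N + 1) prefixWeight σ) :
    Triple P (fill 0 one widths areas levels widths tableValue)
      (fillCost one widths areas levels widths tableValue 1 (N + 1) (N * N + 1) (N + 2) (N + 1))
      (fun σ => P σ ∧ HasTable 0 1 (N + 1) (N * N + 1) (N + 2) (N + 1)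
        (fun _ n d h p => weightTable n d h p) σ) := by
  refine fill_triple hP (fun _ _ => rfl) (fun σ h => eval_widths (hN σ h))
    (fun σ h => eval_areas (hN σ h)) (fun σ h => eval_levels (hN σ h))
    (fun σ h => eval_widths (hN σ h)) ?_
  intro σ h i₁ h₁ i₂ h₂ i₃ h₃ i₄ h₄ i₅ h₅ r₁ r₂ r₃ r₄ r₅ _
  simp only [tableValue, prefixCell, one, eval_add, eval_sub, eval_mul, eval_const, eval_var,
    eval_load, eval_indexExpr, levels, widths, areas, hN σ h, r₂, r₃, r₄, r₅]
  rw [hT σ h _ h₄ _ h₂ _ h₃ _ (by omega) _ h₅,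
    hT σ h _ (by omega) _ h₂ _ h₃ _ (by omega) _ (by omega), weightTable_eq]

theorem fill_marginal {N : ℕ} {P : Memory → Prop} (hP : Stable 1 P)
    (hN : ∀ σ, P σ → σ.reg 0 = N)
    (hT : ∀ σ, P σ → HasTable 0 1 (N + 1) (N * N + 1) (N + 2) (N + 1)
      (fun _ n d h p => weightTable n d h p) σ) :
    Triple P (fill 1 one one widths areas widths marginalValue)
      (fillCost one one widths areas widths marginalValue 1 1 (N + 1) (N * N + 1) (N + 1))
      (fun σ => P σ ∧ HasTable 1 1 1 (N + 1) (N * N + 1) (N + 1)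
        (fun _ _ n d h => heightMarginal n d h) σ) := by
  refine fill_triple hP (fun _ _ => rfl) (fun _ _ => rfl)
    (fun σ h => eval_widths (hN σ h)) (fun σ h => eval_areas (hN σ h))
    (fun σ h => eval_widths (hN σ h)) ?_
  intro σ h i₁ h₁ i₂ h₂ i₃ h₃ i₄ h₄ i₅ h₅ r₁ r₂ r₃ r₄ r₅ _
  simp only [marginalValue, one, eval_add, eval_mul, eval_const, eval_var,
    eval_load, eval_indexExpr, levels, widths, areas, hN σ h, r₃, r₄, r₅]
  exact hT σ h _ (by omega) _ h₃ _ h₄ _ (by omega) _ (by omega)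

/-- A sum over `h` is no expression of fixed size; running sums, each read from the preceding cell
of the same array, make it one. -/
theorem fill_partialSum {N : ℕ} {P : Memory → Prop} (hP : Stable 4 P)
    (hN : ∀ σ, P σ → σ.reg 0 = N)
    (hT : ∀ σ, P σ → HasTable 1 1 1 (N + 1) (N * N + 1) (N + 1)
      (fun _ _ n d h => heightMarginal n d h) σ) :
    Triple P (fill 4 one one widths areas widths partialSumValue)
      (fillCost one one widths areas widths partialSumValue 1 1 (N + 1) (N * N + 1) (N + 1))
      (fun σ => P σ ∧ HasTable 4 1 1 (N + 1) (N * N + 1) (N + 1)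
        (fun _ _ n d h => ∑ k ∈ Finset.range (h + 1), heightMarginal n d k) σ) := by
  refine fill_triple hP (fun _ _ => rfl) (fun _ _ => rfl)
    (fun σ h => eval_widths (hN σ h)) (fun σ h => eval_areas (hN σ h))
    (fun σ h => eval_widths (hN σ h)) ?_
  intro σ h i₁ h₁ i₂ h₂ i₃ h₃ i₄ h₄ i₅ h₅ r₁ r₂ r₃ r₄ r₅ hrec
  simp only [partialSumValue, one, eval_add, eval_sub, eval_mul, eval_const, eval_var,
    eval_load, eval_indexExpr, widths, areas, hN σ h, r₃, r₄, r₅]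
  obtain rfl : i₁ = 0 := by omega
  obtain rfl : i₂ = 0 := by omega
  rw [hT σ h _ (by omega) _ (by omega) _ h₃ _ h₄ _ h₅]
  cases i₅ with
  | zero => simp
  | succ k =>
    rw [Finset.sum_range_succ, Nat.add_sub_cancel,
      hrec _ _ _ _ _ h₂ h₃ h₄ (by omega) (by simp [index])]
    simp

theorem fill_total {N : ℕ} {P : Memory → Prop} (hP : Stable 2 P)
    (hN : ∀ σ, P σ → σ.reg 0 = N)
    (hT : ∀ σ, P σ → HasTable 4 1 1 (N + 1) (N * N + 1) (N + 1)
      (fun _ _ n d h => ∑ k ∈ Finset.range (h + 1), heightMarginal n d k) σ) :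
    Triple P (fill 2 one one one widths areas totalValue)
      (fillCost one one one widths areas totalValue 1 1 1 (N + 1) (N * N + 1))
      (fun σ => P σ ∧ HasTable 2 1 1 1 (N + 1) (N * N + 1)
        (fun _ _ _ n d => totalMarginal n d) σ) := by
  refine fill_triple hP (fun _ _ => rfl) (fun _ _ => rfl)
    (fun _ _ => rfl) (fun σ h => eval_widths (hN σ h))
    (fun σ h => eval_areas (hN σ h)) ?_
  intro σ h i₁ h₁ i₂ h₂ i₃ h₃ i₄ h₄ i₅ h₅ r₁ r₂ r₃ r₄ r₅ _
  simp only [totalValue, one, eval_add, eval_mul, eval_const, eval_var,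
    eval_load, eval_indexExpr, widths, areas, hN σ h, r₄, r₅]
  -- The marginal sums over `h ≤ n`, so it is the running sum at `h = n`.
  exact hT σ h _ (by omega) _ (by omega) _ h₄ _ h₅ _ h₄

/-- The program which computes the three tables. -/
def tableProgram : Stmt :=
  (fill 3 levels widths areas levels widths prefixValue).seq <|
  (fill 0 one widths areas levels widths tableValue).seq <|
  (fill 1 one one widths areas widths marginalValue).seq <|
  (fill 4 one one widths areas widths partialSumValue).seq <|
  fill 2 one one one widths areas totalValue

/-- A bound for the number of steps of the program. -/
def tableCost (N : ℕ) : ℕ :=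
  fillCost levels widths areas levels widths prefixValue
      (N + 2) (N + 1) (N * N + 1) (N + 2) (N + 1) +
    (fillCost one widths areas levels widths tableValue 1 (N + 1) (N * N + 1) (N + 2) (N + 1) +
    (fillCost one one widths areas widths marginalValue 1 1 (N + 1) (N * N + 1) (N + 1) +
    (fillCost one one widths areas widths partialSumValue 1 1 (N + 1) (N * N + 1) (N + 1) +
    fillCost one one one widths areas totalValue 1 1 1 (N + 1) (N * N + 1))))

/-- The box of prefix weights dominates, with degree 1 + 1 + 2 + 1 + 1 = 6. -/
theorem polyBounded_tableCost : PolyBounded 7 tableCost := by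
  have h1 : PolyBounded 0 fun _ => 1 := .const 1 0
  have hw : PolyBounded 1 fun N => N + 1 := PolyBounded.self.add (.const 1 1)
  have hl : PolyBounded 1 fun N => N + 2 := PolyBounded.self.add (.const 2 1)
  have ha : PolyBounded 2 fun N => N * N + 1 :=
    (PolyBounded.self.mul PolyBounded.self).add (.const 1 2)
  have c₁ := (hl.fillCost hw ha hl hw levels widths areas levels widths prefixValue).mono
    (l := 7) (by norm_num)
  have c₂ := (h1.fillCost hw ha hl hw one widths areas levels widths tableValue).mono
    (l := 7) (by norm_num)
  have c₃ := (h1.fillCost h1 hw ha hw one one widths areas widths marginalValue).mono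
    (l := 7) (by norm_num)
  have c₄ := (h1.fillCost h1 hw ha hw one one widths areas widths partialSumValue).mono
    (l := 7) (by norm_num)
  have c₅ := (h1.fillCost h1 h1 hw ha one one one widths areas totalValue).mono
    (l := 7) (by norm_num)
  exact c₁.add (c₂.add (c₃.add (c₄.add c₅)))

/-- Each fill writes to an array of its own, so the earlier tables remain available by stability. -/
theorem tableProgram_triple (N : ℕ) :
    Triple (fun σ => σ.reg 0 = N) tableProgram (tableCost N) (HoldsTables N) := by
  have s₀ (a : ℕ) := stable_reg a N
  have s₁ (a : ℕ) (ha : 3 ≠ a) := (s₀ a).and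
    (stable_hasTable ha (N + 2) (N + 1) (N * N + 1) (N + 2) (N + 1) prefixWeight)
  have s₂ (a : ℕ) (ha : 3 ≠ a) (hb : 0 ≠ a) := (s₁ a ha).and
    (stable_hasTable hb 1 (N + 1) (N * N + 1) (N + 2) (N + 1)
      (fun _ n d h p => weightTable n d h p))
  have s₃ (a : ℕ) (ha : 3 ≠ a) (hb : 0 ≠ a) (hc : 1 ≠ a) := (s₂ a ha hb).and
    (stable_hasTable hc 1 1 (N + 1) (N * N + 1) (N + 1) (fun _ _ n d h => heightMarginal n d h))
  have s₄ := (s₃ 2 (by norm_num) (by norm_num) (by norm_num)).and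
    (stable_hasTable (show 4 ≠ 2 by norm_num) 1 1 (N + 1) (N * N + 1) (N + 1)
      (fun _ _ n d h => ∑ k ∈ Finset.range (h + 1), heightMarginal n d k))
  refine ((fill_prefix (s₀ 3) fun _ h => h).seq
    ((fill_table (s₁ 0 (by norm_num)) (fun _ h => h.1) fun _ h => h.2).seq
    ((fill_marginal (s₂ 1 (by norm_num) (by norm_num)) (fun _ h => h.1.1) fun _ h => h.2).seq
    ((fill_partialSum (s₃ 4 (by norm_num) (by norm_num) (by norm_num)) (fun _ h => h.1.1.1)
      fun _ h => h.2).seq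
    (fill_total s₄ (fun _ h => h.1.1.1.1) fun _ h => h.2))))).mono (fun _ h => h) le_rfl ?_
  rintro σ ⟨⟨⟨⟨-, t₀⟩, t₁⟩, -⟩, t₂⟩
  rw [← sq] at t₀ t₁ t₂
  refine ⟨fun n hn d hd h hh p hp => ?_, fun n hn d hd h hh => ?_, fun n hn d hd => ?_⟩
  · simpa [index] using t₀ 0 one_pos n (by omega) d (by omega) h (by omega) p (by omega)
  · simpa [index] using t₁ 0 one_pos 0 one_pos n (by omega) d (by omega) h (by omega)
  · simpa [index] using t₂ 0 one_pos 0 one_pos 0 one_pos n (by omega) d (by omega)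

theorem exists_program : ∃ (P : Program) (C : ℕ), ∀ N : ℕ, ∃ (t : ℕ) (m : Memory),
    Runs P (inputMemory N) t m ∧ (1 ≤ N → t ≤ C * N ^ 7) ∧ HoldsTables N m := by
  obtain ⟨C, hC⟩ := polyBounded_tableCost
  refine ⟨tableProgram 0, C, fun N => ?_⟩
  -- Variable 0 lives in register 0 and all other registers are zero, so the input memory represents
  -- itself.
  have hrep : Represents (inputMemory N) (inputMemory N) := by
    refine ⟨fun x => ?_, rfl⟩
    rcases eq_or_ne x 0 with rfl | hx
    · rfl
    · simp [inputMemory, hx]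
  obtain ⟨t, ht, m, σ, hrun, hm, hσ, -⟩ :=
    tableProgram_triple N 0 _ _ hrep (by simp [inputMemory])
  refine ⟨t, m, hrun, fun hN => ht.trans (hC N hN), ?_⟩
  rw [HoldsTables, hm.2]
  exact hσ

end DisplacementTable

theorem corollary3 :
    -- the marginal `D(n, d)` is the number of permutations with total displacement `2 d`
    (∀ n d : ℕ, DisplacementTable.totalMarginal n d = DisplacementTable.displacementNumber n d) ∧
    -- for widths up to `N` there are `O(N ^ 5)` parameter values, all others have value zero
    (∃ C : ℕ, ∀ N : ℕ, 1 ≤ N → (DisplacementTable.parameters N).card ≤ C * N ^ 5) ∧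
    (∀ N n d h p : ℕ, n ≤ N → DisplacementTable.weightTable n d h p ≠ 0 →
      (n, d, h, p) ∈ DisplacementTable.parameters N) ∧
    -- one program computes all values of the three tables in `O(N ^ 7)` steps
    (∃ (P : DisplacementTable.Program) (C : ℕ), ∀ N : ℕ,
      ∃ (t : ℕ) (m : DisplacementTable.Memory),
        DisplacementTable.Runs P (DisplacementTable.inputMemory N) t m ∧
        (1 ≤ N → t ≤ C * N ^ 7) ∧
        DisplacementTable.HoldsTables N m) :=
  ⟨DisplacementTable.totalMarginal_eq_displacementNumber,
    ⟨24, fun _ hN => DisplacementTable.card_parameters_le hN⟩,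
    fun _ _ _ _ _ hn hne => DisplacementTable.mem_parameters_of_weightTable_ne_zero hn hne,
    DisplacementTable.exists_program⟩
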